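/- All graphs are undirected and simple (no loops, no multiple edges). A \emph{numbering} of a set $X$ is a bijection $\nu : N \to X$, where $N\subseteq\mathbb{N}$ is decidable. A subset $Y$ of $X$ is decidable if $\nu^{-1}(Y)$ is, and a function $f : X\to X'$ between sets with numberings $\nu,\nu'$ is computable if $\nu'^{-1}\circ f\circ \nu$ is computable; products of numbered sets are numbered by means of a computable pairing function, and $\mathbb{N}$ and $\mathbb{Z}$ carry their standard numberings. A \emph{highly computable graph} is a locally finite graph $\Gamma$ with a numbering of its vertex set $V(\Gamma)$ such that the adjacency relation is decidable and the degree function $V(\Gamma)\to\mathbb{N}$ is computable. A numbering of a group $G$ is \emph{computable} if the group operation $G\times G\to G$ is computable. A \emph{translation-like action} of $\mathbb{Z}$ on a set $X$ with a distance $d$ is a free right action $\ast : X\times\mathbb{Z}\to X$ such that for each $n\in\mathbb{Z}$ the set $\{d(x,x\ast n) : x\in X\}$ is bounded (by a finite number). On a graph, $d$ is the path-length distance between vertices (infinite if they lie in different components); on a finitely generated group it is the word metric $d_S$ of a finite generating set $S$, that is, the path-length distance of the Cayley graph $\mathrm{Cay}(G,S)$. The action is \emph{transitive} if it has only one orbit,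 and it is \emph{computable}, with respect to a numbering of $X$, if the function $X\times\mathbb{Z}\to X$, $(x,n)\mapsto x\ast n$, is computable. \textbf{Corollary.} (1) A highly computable graph admits a transitive translation-like action by $\mathbb{Z}$ if and only if it admits a computable transitive translation-like action by $\mathbb{Z}$. (2) Let $G$ be a finitely generated infinite group with decidable word problem. Then $G$ has a computable numbering, and for every computable numbering $\nu$ of $G$ and every finite generating set $S$ of $G$, the group $G$ admits a transitive translation-like action by $\mathbb{Z}$ with respect to $d_S$ if and only if it admits a transitive translation-like action by $\mathbb{Z}$ with respect to $d_S$ that is computable with respect to $\nu$. -/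

import Mathlib

universe u v

/-- A (bijective) numbering of a set `X`: a bijection from a decidable set of naturals onto `X`. -/
structure BijNumbering (X : Type u) where
  /-- the set of names -/
  dom : Set ℕ
  computable_dom : ComputablePred fun n : ℕ => n ∈ dom
  /-- the bijection which sends a name to the element it represents -/
  toEquiv : dom ≃ X

namespace BijNumbering

/-- The standard numbering of `ℕ`. -/
def nat : BijNumbering ℕ where
  dom := Set.univ
  computable_dom := ⟨fun _ => isTrue trivial, by simpa using Computable.const true⟩
  toEquiv := Equiv.Set.univ ℕ

/-- The standard numbering of `ℤ`, in which `n : ℕ` has the name `2 * n`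
and `-(n + 1)` has the name `2 * n + 1`. -/
def int : BijNumbering ℤ where
  dom := Set.univ
  computable_dom := ⟨fun _ => isTrue trivial, by simpa using Computable.const true⟩
  toEquiv := (Equiv.Set.univ ℕ).trans Equiv.intEquivNat.symm

/-- The product of two numberings, by means of the pairing bijection `Nat.pair`. -/
def prod {X : Type u} {Y : Type v} (ν : BijNumbering X) (μ : BijNumbering Y) : BijNumbering (X × Y) where
  dom := {k | k.unpair.1 ∈ ν.dom ∧ k.unpair.2 ∈ μ.dom}
  computable_dom := by
    obtain ⟨f, hf, hf'⟩ := ComputablePred.computable_iff.1 ν.computable_dom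
    obtain ⟨g, hg, hg'⟩ := ComputablePred.computable_iff.1 μ.computable_dom
    refine ComputablePred.computable_iff.2
      ⟨fun k => f k.unpair.1 && g k.unpair.2,
        Primrec.and.to_comp.comp
          (hf.comp (Computable.fst.comp Computable.unpair))
          (hg.comp (Computable.snd.comp Computable.unpair)), ?_⟩
    funext k
    have h1 : k.unpair.1 ∈ ν.dom ↔ f k.unpair.1 = true := Iff.of_eq (congrFun hf' _)
    have h2 : k.unpair.2 ∈ μ.dom ↔ g k.unpair.2 = true := Iff.of_eq (congrFun hg' _)
    simp [h1, h2]
  toEquiv :=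
    { toFun := fun k => (ν.toEquiv ⟨k.1.unpair.1, k.2.1⟩, μ.toEquiv ⟨k.1.unpair.2, k.2.2⟩)
      invFun := fun p => ⟨Nat.pair (ν.toEquiv.symm p.1) (μ.toEquiv.symm p.2), by simp⟩
      left_inv := fun k => by ext; simp
      right_inv := fun p => by ext <;> simp }

/-- A subset of a numbered set is decidable if the set of names of its elements is decidable. -/
def IsDecidable {X : Type u} (ν : BijNumbering X) (Y : Set X) : Prop :=
  ComputablePred fun n : ℕ => ∃ h : n ∈ ν.dom, ν.toEquiv ⟨n, h⟩ ∈ Y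

/-- A function between numbered sets is computable if some computable function sends each name of
`x` to the name of `f x`. (As the set of names is decidable, it makes no difference whether the
algorithm is required to halt on numbers which are not names.) -/
def IsComputable {X : Type u} {Y : Type v} (ν : BijNumbering X) (μ : BijNumbering Y) (f : X → Y) : Prop :=
  ∃ g : ℕ → ℕ, Computable g ∧ ∀ n : ν.dom, g n = μ.toEquiv.symm (f (ν.toEquiv n))

end BijNumbering

/-- `(Γ, ν)` is a computable graph: adjacency is a decidable relation. -/
def IsComputableGraph {V : Type u} (Γ : SimpleGraph V) (ν : BijNumbering V) : Prop :=
  (ν.prod ν).IsDecidable {p : V × V | Γ.Adj p.1 p.2}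

/-- `(Γ, ν)` is a highly computable graph: it is a computable graph, it is locally finite, and the
degree function is computable. -/
structure IsHighlyComputableGraph {V : Type u} (Γ : SimpleGraph V) (ν : BijNumbering V) : Prop where
  computable : IsComputableGraph Γ ν
  locallyFinite : ∀ v, (Γ.neighborSet v).Finite
  degree : ν.IsComputable BijNumbering.nat fun v => (Γ.neighborSet v).ncard

/-- A numbering of a group is computable if it makes the group operation computable. -/
def IsComputableGroupNumbering {G : Type u} [Group G] (ν : BijNumbering G) : Prop :=
  (ν.prod ν).IsComputable ν fun p : G × G => p.1 * p.2

/-- The group element represented by a word in the letters `(i, true)`, which stands for `s i`, and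
`(i, false)`, which stands for `(s i)⁻¹`. -/
def wordEval {G : Type u} [Group G] {k : ℕ} (s : Fin k → G) (w : List (Fin k × Bool)) : G :=
  (w.map fun a => bif a.2 then s a.1 else (s a.1)⁻¹).prod

/-- `G` is finitely generated and, for some finite generating family, it is decidable whether a word
in the generators and their inverses represents the identity. (This then holds for every finite
generating family.) -/
def HasDecidableWordProblem (G : Type u) [Group G] : Prop :=
  ∃ (k : ℕ) (s : Fin k → G), Subgroup.closure (Set.range s) = ⊤ ∧
    ComputablePred fun w : List (Fin k × Bool) => wordEval s w = 1

/-- `act : X → H → X`, written `x ∗ h`, is a right action of the (additively written) group `H`. -/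
structure IsRightAction {X : Type u} {H : Type v} [AddGroup H] (act : X → H → X) : Prop where
  act_zero : ∀ x, act x 0 = x
  act_add : ∀ x g h, act x (g + h) = act (act x g) h

/-- `act` is a translation-like action of `H` on `X` with respect to the (possibly infinite-valued)
distance `d`: it is a free right action, and for each `h` the set of distances `d x (x ∗ h)` is
bounded (by a finite number). -/
structure IsTranslationLikeAction {X : Type u} {H : Type v} [AddGroup H] (d : X → X → ℕ∞)
    (act : X → H → X) : Prop extends IsRightAction act where
  free : ∀ x h, act x h = x → h = 0
  bounded : ∀ h, ∃ C : ℕ, ∀ x, d x (act x h) ≤ C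

/-- An action is transitive if it has only one orbit. -/
def IsTransitiveAction {X : Type u} {H : Type v} (act : X → H → X) : Prop :=
  ∀ x y, ∃ h, act x h = y

/-- An action of `ℤ` on a numbered set is computable if `(x, n) ↦ x ∗ n` is computable. -/
def IsComputableIntAction {X : Type u} (ν : BijNumbering X) (act : X → ℤ → X) : Prop :=
  (ν.prod BijNumbering.int).IsComputable ν fun p : X × ℤ => act p.1 p.2

/-- The path-length metric on the vertices of a graph, infinite between distinct components. -/
noncomputable def pathMetric {V : Type u} (Γ : SimpleGraph V) : V → V → ℕ∞ := Γ.edist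

/-- The word metric on a group with respect to `S`, which is the path-length metric of the
(undirected, right) Cayley graph, where `g ≠ h` are adjacent iff `g * s = h` for some
`s ∈ S ∪ S⁻¹`. -/
noncomputable def wordMetric {G : Type u} [Group G] (S : Set G) : G → G → ℕ∞ :=
  pathMetric (SimpleGraph.mulCayley S)

/-! On a nonempty vertex set, a transitive translation-like action of ℤ amounts to a bijective
enumeration of the vertices by ℤ with bounded jumps: take the orbit map of a point, or conversely
translate indices. The given enumeration need not be computable. It serves only to show that, for a
suitable `C`, the relation `T` of being at distance at most `C` is connected and has at most two
ends. Finite lists of `T`-neighbours are computable because degrees are.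

If `T` has at most one end, a computable Hamiltonian ray of its cube is built by extending finite
paths. A path may be kept only if its complement is connected. This looks undecidable, but a finite
walk in the complement that meets every outside neighbour of the path certifies it
(`IsCertifiedPath.connectedIn`). One-endedness and Sekanina's theorem on cubes of finite connected
graphs (`exists_isHamPath`) show that a certified path can always be extended through any prescribed
point (`exists_isCertifiedPath_append`), so a blind search for extensions never gets stuck. Folding
the ray in two gives a line.

Otherwise some finite `F` separates the two tails of the enumeration. The components `A` and `B` of
these tails in the complement of `F` cover all but finitely many points, are decidable because a
path to one base point or the other can be searched for, and have one end each. Each carries a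
computable ray. The finite remainder is put in front of the ray of `A`, and the two rays form the
line (`hasBoundedLine_of_int`). Only finite data such as `F` enter the algorithm non-uniformly.

For groups, right multiplication by a fixed finite set makes the Cayley graph highly computable,
which reduces (2) to (1). -/

section ComputabilityToolkit

/-! ### Decidable predicates, bounded quantifiers and unbounded search. -/

variable {α β γ : Type*} [Primcodable α] [Primcodable β] [Primcodable γ]

theorem ComputablePred.comp' {p : β → Prop} (hp : ComputablePred p) {f : α → β} (hf : Computable f) :
    ComputablePred fun a => p (f a) := by
  obtain ⟨g, hg, rfl⟩ := ComputablePred.computable_iff.1 hp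
  exact ComputablePred.computable_iff.2 ⟨fun a => g (f a), hg.comp hf, rfl⟩

theorem ComputablePred.and' {p q : α → Prop} (hp : ComputablePred p) (hq : ComputablePred q) :
    ComputablePred fun a => p a ∧ q a := by
  obtain ⟨f, hf, rfl⟩ := ComputablePred.computable_iff.1 hp
  obtain ⟨g, hg, rfl⟩ := ComputablePred.computable_iff.1 hq
  exact ComputablePred.computable_iff.2
    ⟨fun a => f a && g a, Primrec.and.to_comp.comp hf hg, by funext a; simp⟩

theorem ComputablePred.or' {p q : α → Prop} (hp : ComputablePred p) (hq : ComputablePred q) :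
    ComputablePred fun a => p a ∨ q a := by
  obtain ⟨f, hf, rfl⟩ := ComputablePred.computable_iff.1 hp
  obtain ⟨g, hg, rfl⟩ := ComputablePred.computable_iff.1 hq
  exact ComputablePred.computable_iff.2
    ⟨fun a => f a || g a, Primrec.or.to_comp.comp hf hg, by funext a; simp⟩

theorem ComputablePred.imp' {p q : α → Prop} (hp : ComputablePred p) (hq : ComputablePred q) :
    ComputablePred fun a => p a → q a :=
  (hp.not.or' hq).of_eq fun _ => imp_iff_not_or.symm

theorem ComputablePred.eq' {f g : α → β} (hf : Computable f) (hg : Computable g) :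
    ComputablePred fun a => f a = g a := by
  classical
  exact (PrimrecRel.comp (R := fun x y : β => x = y) Primrec.eq Primrec.fst
    Primrec.snd).computablePred.comp' (hf.pair hg)

theorem ComputablePred.lt' {f g : α → ℕ} (hf : Computable f) (hg : Computable g) :
    ComputablePred fun a => f a < g a :=
  (PrimrecRel.comp (R := fun x y : ℕ => x < y) Primrec.nat_lt Primrec.fst
    Primrec.snd).computablePred.comp' (hf.pair hg)

theorem ComputablePred.forall_lt' {P : α → ℕ → Prop}
    (hP : ComputablePred fun p : α × ℕ => P p.1 p.2) {f : α → ℕ} (hf : Computable f) :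
    ComputablePred fun a => ∀ i < f a, P a i := by
  obtain ⟨g, hg, hg'⟩ := ComputablePred.computable_iff.1 hP
  have key : Computable fun a => Nat.rec (motive := fun _ => Bool) true
      (fun n b => g (a, n) && b) (f a) := by
    refine Computable.nat_rec hf (Computable.const true)
      (h := fun a (p : ℕ × Bool) => g (a, p.1) && p.2) ?_
    exact Primrec.and.to_comp.comp
      (hg.comp (Computable.fst.pair (Computable.fst.comp Computable.snd)))
      (Computable.snd.comp Computable.snd)
  refine ComputablePred.computable_iff.2 ⟨_, key, ?_⟩
  funext a
  have h : ∀ n, (Nat.rec (motive := fun _ => Bool) true (fun n b => g (a, n) && b) n = true) ↔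
      ∀ i < n, P a i := by
    intro n
    induction n with
    | zero => simp
    | succ n ih =>
      have : P a n ↔ g (a, n) = true := Iff.of_eq (congrFun hg' (a, n))
      simp only [Bool.and_eq_true, ih, ← this, Nat.forall_lt_succ_right]
      tauto
  exact propext (h _).symm

theorem ComputablePred.forall_mem' {P : α → β → Prop}
    (hP : ComputablePred fun p : α × β => P p.1 p.2) {l : α → List β} (hl : Computable l) :
    ComputablePred fun a => ∀ b ∈ l a, P a b := by
  obtain ⟨g, hg, hg'⟩ := ComputablePred.computable_iff.1 hP
  have key : ComputablePred fun p : α × ℕ =>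
      (Option.casesOn (motive := fun _ => Bool) (l p.1)[p.2]? true (fun b => g (p.1, b))) = true :=
    ComputablePred.eq' (Computable.option_casesOn
      (Computable.list_getElem?.comp (hl.comp Computable.fst) Computable.snd)
      (Computable.const true)
      (hg.comp ((Computable.fst.comp Computable.fst).pair Computable.snd)))
      (Computable.const true)
  refine (ComputablePred.forall_lt' (P := fun a i => (Option.casesOn (motive := fun _ => Bool)
    (l a)[i]? true (fun b => g (a, b))) = true) key (Computable.list_length.comp hl)).of_eq
    fun a => ?_
  have h : ∀ b, P a b ↔ g (a, b) = true := fun b => Iff.of_eq (congrFun hg' (a, b))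
  constructor
  · intro H b hb
    obtain ⟨i, hi, rfl⟩ := List.mem_iff_getElem.1 hb
    have := H i hi
    rw [List.getElem?_eq_getElem hi] at this
    exact (h _).2 this
  · intro H i hi
    rw [List.getElem?_eq_getElem hi]
    exact (h _).1 (H _ (List.getElem_mem hi))

theorem ComputablePred.exists_mem' {P : α → β → Prop}
    (hP : ComputablePred fun p : α × β => P p.1 p.2) {l : α → List β} (hl : Computable l) :
    ComputablePred fun a => ∃ b ∈ l a, P a b :=
  (ComputablePred.forall_mem' (P := fun a b => ¬ P a b) hP.not hl).not.of_eq fun a => by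
    push Not; rfl

theorem ComputablePred.mem_list {f : α → β} {l : α → List β} (hf : Computable f)
    (hl : Computable l) : ComputablePred fun a => f a ∈ l a :=
  (ComputablePred.exists_mem' (P := fun a b => b = f a)
    (ComputablePred.eq' Computable.snd (hf.comp Computable.fst)) hl).of_eq fun a => by simp

theorem ComputablePred.nodup {l : α → List β} (hl : Computable l) :
    ComputablePred fun a => (l a).Nodup := by
  have hget : ∀ {δ : Type _} [Primcodable δ] {f : δ → α} {i : δ → ℕ}, Computable f → Computable i →
      Computable fun d => (l (f d))[i d]? := fun hf hi => Computable.list_getElem?.comp (hl.comp hf) hi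
  refine (ComputablePred.forall_lt' (P := fun a j => ∀ i < j, (l a)[i]? ≠ (l a)[j]?) ?_
    (Computable.list_length.comp hl)).of_eq fun a => ?_
  · refine ComputablePred.forall_lt' (P := fun (p : α × ℕ) i => (l p.1)[i]? ≠ (l p.1)[p.2]?) ?_
      Computable.snd
    exact (ComputablePred.eq' (hget (Computable.fst.comp Computable.fst) Computable.snd)
      (hget (Computable.fst.comp Computable.fst) (Computable.snd.comp Computable.fst))).not
  · rw [List.nodup_iff_getElem?_ne_getElem?]
    exact ⟨fun H i j hij hj => H j hj i hij, fun H j hj i hij => H i j hij hj⟩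

theorem ComputablePred.isChain {R : ℕ → ℕ → Prop} (hR : ComputablePred fun p : ℕ × ℕ => R p.1 p.2)
    {l : α → List ℕ} (hl : Computable l) : ComputablePred fun a => (l a).IsChain R := by
  have hget : Computable₂ fun (a : α) (i : ℕ) => (l a).getD i 0 :=
    (Primrec.list_getD 0).to_comp.comp (hl.comp Computable.fst) Computable.snd
  -- Truncated subtraction makes the empty list vacuous, and below this bound both indices are in
  -- range, so the default `0` is never read.
  refine (ComputablePred.forall_lt' (P := fun a i => R ((l a).getD i 0) ((l a).getD (i + 1) 0)) ?_
    (f := fun a => (l a).length - 1)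
    (Primrec.nat_sub.to_comp.comp (Computable.list_length.comp hl) (Computable.const 1))).of_eq
    fun a => ?_
  · exact hR.comp' (Computable.pair hget
      (hget.comp Computable.fst (Computable.succ.comp Computable.snd)))
  · rw [List.isChain_iff_getElem]
    constructor
    · intro H i hi
      have := H i (by omega)
      rwa [List.getD_eq_getElem _ _ (by omega), List.getD_eq_getElem _ _ hi] at this
    · intro H i hi
      rw [List.getD_eq_getElem _ _ (by omega), List.getD_eq_getElem _ _ (by omega)]
      exact H i (by omega)

/-- A computable binary relation has a partial computable choice function. -/
theorem exists_partrec_choice {R : α → β → Prop}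
    (hR : ComputablePred fun p : α × β => R p.1 p.2) :
    ∃ f : α →. β, Partrec f ∧ (∀ a, ∀ b ∈ f a, R a b) ∧ ∀ a, (∃ b, R a b) → (f a).Dom := by
  obtain ⟨g, hg, hg'⟩ := ComputablePred.computable_iff.1 hR
  have h : ∀ a b, R a b ↔ g (a, b) = true := fun a b => Iff.of_eq (congrFun hg' (a, b))
  have hc : Computable₂ fun (a : α) (n : ℕ) =>
      (Encodable.decode (α := β) n).bind fun b => bif g (a, b) then some b else none := by
    refine Computable.option_bind (Computable.decode.comp Computable.snd) ?_
    exact Computable.cond (hg.comp ((Computable.fst.comp Computable.fst).pair Computable.snd))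
      (Computable.option_some.comp Computable.snd) (Computable.const none)
  refine ⟨_, Partrec.rfindOpt hc, ?_, ?_⟩
  · intro a b hb
    obtain ⟨n, hn⟩ := Nat.rfindOpt_spec hb
    simp only [Option.mem_def, Option.bind_eq_some_iff] at hn
    obtain ⟨b', -, hb'⟩ := hn
    cases hgb : g (a, b') <;> simp [hgb] at hb'
    subst hb'
    exact (h _ _).2 hgb
  · rintro a ⟨b, hb⟩
    refine Nat.rfindOpt_dom.2 ⟨Encodable.encode b, b, ?_⟩
    simp [(h _ _).1 hb]

/-- A total computable binary relation has a computable choice function. -/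
theorem exists_computable_choice {R : α → β → Prop}
    (hR : ComputablePred fun p : α × β => R p.1 p.2) (hex : ∀ a, ∃ b, R a b) :
    ∃ f : α → β, Computable f ∧ ∀ a, R a (f a) := by
  obtain ⟨f, hf, hfR, hdom⟩ := exists_partrec_choice hR
  refine ⟨fun a => (f a).get (hdom a (hex a)), ?_, fun a => hfR a _ (Part.get_mem _)⟩
  exact Partrec.of_eq_tot hf fun a => Part.get_mem _

/-- Given a computable relation `R` and an invariant that can always be continued along `R`, there
is a computable infinite `R`-chain. -/
theorem exists_computable_seq {R : α → α → Prop}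
    (hR : ComputablePred fun p : α × α => R p.1 p.2) {I : α → Prop} {a₀ : α} (h₀ : I a₀)
    (hex : ∀ a, I a → ∃ b, R a b) (hI : ∀ a b, I a → R a b → I b) :
    ∃ s : ℕ → α, Computable s ∧ s 0 = a₀ ∧ (∀ n, I (s n)) ∧ ∀ n, R (s n) (s (n + 1)) := by
  obtain ⟨f, hf, hfR, hdom⟩ := exists_partrec_choice hR
  let t : ℕ →. α := fun n => Nat.rec (motive := fun _ => Part α) (Part.some a₀)
    (fun _ IH => IH.bind f) n
  have ht : Partrec t := by
    refine Partrec.nat_rec (f := fun n : ℕ => n) (g := fun _ : ℕ => Part.some a₀)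
      (h := fun _ (p : ℕ × α) => f p.2) Computable.id (Computable.const a₀) ?_
    exact hf.comp (Computable.snd.comp Computable.snd)
  -- The iteration is a priori partial. The invariant, which need not be decidable, guarantees that
  -- each search halts.
  have key : ∀ n, ∃ a ∈ t n, I a := by
    intro n
    induction n with
    | zero => exact ⟨a₀, Part.mem_some _, h₀⟩
    | succ n ih =>
      obtain ⟨a, ha, hIa⟩ := ih
      have hd := hdom a (hex a hIa)
      exact ⟨(f a).get hd, Part.mem_bind ha (Part.get_mem hd), hI _ _ hIa (hfR _ _ (Part.get_mem hd))⟩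
  choose s hs hsI using key
  refine ⟨s, Partrec.of_eq_tot ht hs, ?_, hsI, fun n => ?_⟩
  · exact Part.mem_some_iff.1 (hs 0)
  · obtain ⟨a, ha, hb⟩ := Part.mem_bind_iff.1 (hs (n + 1))
    rw [Part.mem_unique (hs n) ha]
    exact hfR _ _ hb

end ComputabilityToolkit

/-! ### Connectivity, ends, and Hamiltonian paths in cubes of graphs. -/

section Connectivity

variable {α : Type*} {T : α → α → Prop}

/-- `x` and `y` are joined by a `T`-path inside `S`. -/
def LinkedIn (T : α → α → Prop) (S : Set α) : α → α → Prop :=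
  Relation.ReflTransGen fun x y => T x y ∧ x ∈ S ∧ y ∈ S

/-- Any two points of `S` are joined by a `T`-path inside `S`. -/
def ConnectedIn (T : α → α → Prop) (S : Set α) : Prop :=
  ∀ x ∈ S, ∀ y ∈ S, LinkedIn T S x y

/-- Three-step neighbours. -/
def ThreeStep (T : α → α → Prop) (a d : α) : Prop :=
  ∃ b c, T a b ∧ T b c ∧ T c d

/-- `S` has at most one end: every finite set is disjoint from a connected cofinite subset. -/
def AtMostOneEnd (T : α → α → Prop) (S : Set α) : Prop :=
  ∀ F : Set α, F.Finite → ∃ U ⊆ S \ F, (S \ U).Finite ∧ ConnectedIn T U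

theorem LinkedIn.refl {S : Set α} (x : α) : LinkedIn T S x x := Relation.ReflTransGen.refl

theorem LinkedIn.trans {S : Set α} {x y z : α} (h : LinkedIn T S x y) (h' : LinkedIn T S y z) :
    LinkedIn T S x z := Relation.ReflTransGen.trans h h'

theorem LinkedIn.single {S : Set α} {x y : α} (h : T x y) (hx : x ∈ S) (hy : y ∈ S) :
    LinkedIn T S x y := Relation.ReflTransGen.single ⟨h, hx, hy⟩

theorem LinkedIn.symm (hT : ∀ a b, T a b → T b a) {S : Set α} {x y : α} (h : LinkedIn T S x y) :
    LinkedIn T S y x := by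
  have : Std.Symm fun x y => T x y ∧ x ∈ S ∧ y ∈ S :=
    ⟨fun a b h => ⟨hT _ _ h.1, h.2.2, h.2.1⟩⟩
  exact Relation.ReflTransGen.stdSymm.symm _ _ h

theorem LinkedIn.mono {S S' : Set α} (hS : S ⊆ S') {x y : α} (h : LinkedIn T S x y) :
    LinkedIn T S' x y :=
  Relation.ReflTransGen.mono (fun _ _ h => ⟨h.1, hS h.2.1, hS h.2.2⟩) _ _ h

/-- A path stays within any set which contains everything linked to its starting point. -/
theorem LinkedIn.mono_of_forall {S S' : Set α} {x y : α} (h : LinkedIn T S x y) (hx : x ∈ S')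
    (hS : ∀ z ∈ S, LinkedIn T S x z → z ∈ S') : LinkedIn T S' x y ∧ y ∈ S' := by
  induction h with
  | refl => exact ⟨LinkedIn.refl _, hx⟩
  | @tail b c hb hc ih =>
    have := hS c hc.2.2 (Relation.ReflTransGen.tail hb hc)
    exact ⟨ih.1.trans (LinkedIn.single hc.1 ih.2 this), this⟩

/-- A path from outside `B` to `B` has a last point before it first meets `B`. -/
theorem LinkedIn.exists_first_hit {S B : Set α} {x y : α} (h : LinkedIn T S x y) (hxS : x ∈ S)
    (hx : x ∉ B) (hy : y ∈ B) :
    ∃ z w, LinkedIn T (S \ B) x z ∧ z ∈ S \ B ∧ T z w ∧ w ∈ B ∧ w ∈ S := by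
  by_contra! H
  have : ∀ z, LinkedIn T S x z → LinkedIn T (S \ B) x z ∧ z ∈ S \ B := by
    intro z hz
    induction hz with
    | refl => exact ⟨LinkedIn.refl _, hxS, hx⟩
    | @tail b c hb hc ih =>
      have hcB : c ∉ B := fun hcB => H b c ih.1 ih.2 hc.1 hcB hc.2.2
      exact ⟨ih.1.trans (LinkedIn.single hc.1 ih.2 ⟨hc.2.2, hcB⟩), hc.2.2, hcB⟩
  exact (this y h).2.2 hy

theorem connectedIn_of_center (hT : ∀ a b, T a b → T b a) {S : Set α} {c : α}
    (h : ∀ x ∈ S, LinkedIn T S x c) : ConnectedIn T S :=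
  fun x hx y hy => (h x hx).trans ((h y hy).symm hT)

theorem LinkedIn.exists_isChain {S : Set α} {x y : α} (h : LinkedIn T S x y) (hx : x ∈ S) :
    ∃ l : List α, l.IsChain T ∧ (∀ z ∈ l, z ∈ S) ∧ l.head? = some x ∧ l.getLast? = some y := by
  induction h with
  | refl => exact ⟨[x], by simp, by simpa, by simp, by simp⟩
  | @tail b c hb hc ih =>
    obtain ⟨l, h1, h2, h3, h4⟩ := ih
    refine ⟨l ++ [c], ?_, ?_, ?_, by simp⟩
    · refine h1.append (by simp) ?_
      intro a ha d hd
      rw [h4] at ha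
      simp only [Option.mem_def, Option.some.injEq, List.head?_cons] at ha hd
      subst ha hd
      exact hc.1
    · intro z hz
      rcases List.mem_append.1 hz with hz | hz
      · exact h2 z hz
      · rw [List.mem_singleton.1 hz]; exact hc.2.2
    · simp [h3]

theorem linkedIn_of_isChain {S : Set α} {l : List α} (hl : l.IsChain T) (hS : ∀ z ∈ l, z ∈ S)
    {x : α} (hx : l.head? = some x) : ∀ y ∈ l, LinkedIn T S x y := by
  induction l generalizing x with
  | nil => simp
  | cons a l ih =>
    simp only [List.head?_cons, Option.some.injEq] at hx
    subst hx
    intro y hy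
    rcases List.mem_cons.1 hy with rfl | hy
    · exact LinkedIn.refl _
    · cases l with
      | nil => simp at hy
      | cons b l =>
        rw [List.isChain_cons_cons] at hl
        exact (LinkedIn.single hl.1 (hS _ (by simp)) (hS _ (by simp))).trans
          (ih hl.2 (fun z hz => hS z (List.mem_cons_of_mem _ hz)) (by simp) y hy)

theorem isChain_append_of_getLast?_head? {R : α → α → Prop} {l m : List α} {a b : α}
    (hl : l.IsChain R) (hm : m.IsChain R) (ha : l.getLast? = some a) (hb : m.head? = some b)
    (hab : R a b) : (l ++ m).IsChain R := by
  refine hl.append hm ?_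
  intro x hx y hy
  rw [ha] at hx
  rw [hb] at hy
  simp only [Option.mem_def, Option.some.injEq] at hx hy
  subst hx hy
  exact hab

/-- In a connected set, a walk can be made to visit any given finite list of points. -/
theorem ConnectedIn.exists_walk {S : Set α} (hS : ConnectedIn T S) (hrefl : ∀ a, T a a)
    {x : α} (hx : x ∈ S) (l : List α) (hl : ∀ z ∈ l, z ∈ S) :
    ∃ W : List α, W.IsChain T ∧ (∀ z ∈ W, z ∈ S) ∧ W.head? = some x ∧ ∀ z ∈ l, z ∈ W := by
  induction l generalizing x with
  | nil => exact ⟨[x], by simp, by simpa, by simp, by simp⟩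
  | cons a l ih =>
    have ha : a ∈ S := hl a (by simp)
    obtain ⟨W, h1, h2, h3, h4⟩ := ih ha fun z hz => hl z (List.mem_cons_of_mem _ hz)
    obtain ⟨W', h1', h2', h3', h4'⟩ := (hS x hx a ha).exists_isChain hx
    refine ⟨W' ++ W, isChain_append_of_getLast?_head? h1' h1 h4' h3 (hrefl a), ?_, by simp [h3'], ?_⟩
    · intro z hz
      rcases List.mem_append.1 hz with hz | hz
      · exact h2' z hz
      · exact h2 z hz
    · intro z hz
      rcases List.mem_cons.1 hz with rfl | hz
      · exact List.mem_append_left _ (List.mem_of_getLast? h4')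
      · exact List.mem_append_right _ (h4 z hz)

/-- `l` is a Hamiltonian path from `a` to `b` in the cube of `(A, T)`. -/
structure IsHamPath (T : α → α → Prop) (A : Set α) (a b : α) (l : List α) : Prop where
  nodup : l.Nodup
  mem_iff : ∀ x, x ∈ l ↔ x ∈ A
  isChain : l.IsChain (ThreeStep T)
  head : l.head? = some a
  last : l.getLast? = some b

theorem IsHamPath.append {A B : Set α} {a b c d : α} {l m : List α} (hl : IsHamPath T A a b l)
    (hm : IsHamPath T B c d m) (hAB : Disjoint A B) (hbc : ThreeStep T b c) :
    IsHamPath T (A ∪ B) a d (l ++ m) where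
  nodup := hl.nodup.append hm.nodup fun x hx hx' =>
    Set.disjoint_left.1 hAB ((hl.mem_iff x).1 hx) ((hm.mem_iff x).1 hx')
  mem_iff x := by simp [hl.mem_iff, hm.mem_iff]
  isChain := isChain_append_of_getLast?_head? hl.isChain hm.isChain hl.last hm.head hbc
  head := by simp [hl.head]
  last := by simp [hm.last]

theorem isHamPath_singleton (a : α) : IsHamPath T {a} a a [a] where
  nodup := by simp
  mem_iff := by simp
  isChain := by simp
  head := by simp
  last := by simp

theorem ConnectedIn.exists_neighbor {S : Set α} (hS : ConnectedIn T S) {x y : α} (hx : x ∈ S)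
    (hy : y ∈ S) (hxy : x ≠ y) (hT : ∀ a b, T a b → T b a) : ∃ z ∈ S, z ≠ x ∧ T x z := by
  obtain ⟨z, w, -, hz, hzw, hw, -⟩ :=
    (hS y hy x hx).exists_first_hit hy (B := {x}) (fun h => hxy h.symm) rfl
  rw [Set.mem_singleton_iff] at hw
  subst hw
  exact ⟨z, hz.1, hz.2, hT _ _ hzw⟩

/-- **Sekanina's theorem**: the cube of a finite connected graph is Hamiltonian-connected. -/
theorem exists_isHamPath (hT : ∀ a b, T a b → T b a) (hrefl : ∀ a, T a a) (n : ℕ) :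
    ∀ A : Set α, A.Finite → A.ncard ≤ n → ConnectedIn T A → ∀ u ∈ A, ∀ w ∈ A, u ≠ w →
      ∃ l, IsHamPath T A u w l := by
  induction n with
  | zero =>
    intro A hA hn _ u hu
    rw [Nat.le_zero, Set.ncard_eq_zero hA] at hn
    simp [hn] at hu
  | succ n ih =>
    intro A hA hn hconn u hu w hw huw
    -- For a one-point set the path must end where it starts; otherwise it is made to end at a
    -- neighbour of `u`.
    have ih' : ∀ A : Set α, A.Finite → A.ncard ≤ n → ConnectedIn T A → ∀ u ∈ A,
        ∃ u' l, T u u' ∧ IsHamPath T A u u' l := by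
      intro A hA hn hconn u hu
      by_cases h : ∃ y ∈ A, u ≠ y
      · obtain ⟨y, hy, huy⟩ := h
        obtain ⟨z, hz, hzu, huz⟩ := hconn.exists_neighbor hu hy huy hT
        obtain ⟨l, hl⟩ := ih A hA hn hconn u hu z hz hzu.symm
        exact ⟨z, l, huz, hl⟩
      · push Not at h
        have : A = {u} := by
          ext y
          exact ⟨fun hy => (h y hy).symm, fun hy => by rw [Set.mem_singleton_iff.1 hy]; exact hu⟩
        subst this
        exact ⟨u, [u], hrefl u, isHamPath_singleton u⟩
    -- Cut `A` at `u`. Both `B` and `A \ B` are connected and smaller than `A`; the path runs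
    -- through `A \ B` from `u` back to the vicinity of `u`, then jumps into `B` and ends at `w`.
    let B : Set α := {x | x ∈ A \ {u} ∧ LinkedIn T (A \ {u}) x w}
    have hwB : w ∈ B := ⟨⟨hw, fun h => huw h.symm⟩, LinkedIn.refl _⟩
    have huB : u ∉ B := fun h => h.1.2 rfl
    have hBA : B ⊆ A := fun x hx => hx.1.1
    have hBfin : B.Finite := hA.subset hBA
    have hBconn : ConnectedIn T B := by
      refine connectedIn_of_center hT (c := w) fun x hx => ?_
      refine (hx.2.mono_of_forall hx ?_).1
      exact fun z hz hxz => ⟨hz, (hxz.symm hT).trans hx.2⟩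
    have hA'conn : ConnectedIn T (A \ B) := by
      refine connectedIn_of_center hT (c := u) fun x hx => ?_
      by_cases hxu : x = u
      · rw [hxu]; exact LinkedIn.refl _
      obtain ⟨z, v, hxz, hz, hzv, hv, -⟩ :=
        (hconn x hx.1 u hu).exists_first_hit hx.1 (B := {u}) hxu rfl
      rw [Set.mem_singleton_iff] at hv
      subst hv
      have := hxz.mono_of_forall (S' := A \ B) hx fun y hy hxy =>
        ⟨hy.1, fun hyB => hx.2 ⟨⟨hx.1, hxu⟩, hxy.trans hyB.2⟩⟩
      exact this.1.trans (LinkedIn.single hzv this.2 ⟨hu, huB⟩)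
    have hBcard : B.ncard ≤ n := by
      have : B.ncard < A.ncard := Set.ncard_lt_ncard ⟨hBA, fun h => huB (h hu)⟩ hA
      omega
    have hA'card : (A \ B).ncard ≤ n := by
      have : (A \ B).ncard < A.ncard :=
        Set.ncard_lt_ncard ⟨Set.sdiff_subset, fun h => (h hw).2 hwB⟩ hA
      omega
    obtain ⟨u', l₁, huu', hl₁⟩ := ih' (A \ B) hA.sdiff hA'card hA'conn u ⟨hu, huB⟩
    have hunion : A \ B ∪ B = A := Set.sdiff_union_of_subset hBA
    have hdisj : Disjoint (A \ B) B := Set.disjoint_sdiff_left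
    suffices ∃ c l₂, IsHamPath T B c w l₂ ∧ ThreeStep T u' c by
      obtain ⟨c, l₂, hl₂, hc⟩ := this
      exact ⟨l₁ ++ l₂, hunion ▸ hl₁.append hl₂ hdisj hc⟩
    -- Here `z` is a neighbour of `u` in `B`. If `z ≠ w`, the path enters `B` at `z`; if `z = w`, it
    -- enters at a neighbour of `z`, unless `B` is a single point. From `u'` the jump goes through
    -- `u`, and through `z` if needed, hence at most three steps.
    obtain ⟨z, v, hwz, hz, hzv, hv, -⟩ :=
      (hconn w hw u hu).exists_first_hit hw (B := {u}) (fun h => huw h.symm) rfl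
    rw [Set.mem_singleton_iff] at hv
    subst hv
    have hzB : z ∈ B := ⟨hz, hwz.symm hT⟩
    by_cases hzw : z = w
    · subst hzw
      by_cases h : ∃ y ∈ B, z ≠ y
      · obtain ⟨y, hy, hzy⟩ := h
        obtain ⟨z', hz', hz'z, hzz'⟩ := hBconn.exists_neighbor hzB hy hzy hT
        obtain ⟨l₂, hl₂⟩ := ih B hBfin hBcard hBconn z' hz' z hzB hz'z
        exact ⟨z', l₂, hl₂, v, z, hT _ _ huu', hT _ _ hzv, hzz'⟩
      · push Not at h
        have : B = {z} := by
          ext y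
          exact ⟨fun hy => (h y hy).symm, fun hy => by rw [Set.mem_singleton_iff.1 hy]; exact hzB⟩
        rw [this]
        exact ⟨z, [z], isHamPath_singleton z, v, v, hT _ _ huu', hrefl _, hT _ _ hzv⟩
    · obtain ⟨l₂, hl₂⟩ := ih B hBfin hBcard hBconn z hzB w hwB hzw
      exact ⟨z, l₂, hl₂, v, v, hT _ _ huu', hrefl _, hT _ _ hzv⟩

/-- Letting the endpoint move by one step removes the requirement in Sekanina's theorem that the
endpoints differ. -/
theorem exists_isHamPath_of_connectedIn (hT : ∀ a b, T a b → T b a) (hrefl : ∀ a, T a a)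
    {A : Set α} (hA : A.Finite) (hconn : ConnectedIn T A) {u w : α} (hu : u ∈ A) (hw : w ∈ A) :
    ∃ w' l, T w w' ∧ IsHamPath T A u w' l := by
  by_cases huw : u = w
  · subst huw
    by_cases h : ∃ y ∈ A, u ≠ y
    · obtain ⟨y, hy, huy⟩ := h
      obtain ⟨z, hz, hzu, huz⟩ := hconn.exists_neighbor hu hy huy hT
      obtain ⟨l, hl⟩ := exists_isHamPath hT hrefl _ A hA le_rfl hconn u hu z hz hzu.symm
      exact ⟨z, l, huz, hl⟩
    · push Not at h
      have : A = {u} := by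
        ext y
        exact ⟨fun hy => (h y hy).symm, fun hy => by rw [Set.mem_singleton_iff.1 hy]; exact hu⟩
      subst this
      exact ⟨u, [u], hrefl u, isHamPath_singleton u⟩
  · obtain ⟨l, hl⟩ := exists_isHamPath hT hrefl _ A hA le_rfl hconn u hu w hw huw
    exact ⟨w, l, hrefl w, hl⟩

/-- In a connected set with one end, two points lie in a finite connected subset with connected
complement, and a Hamiltonian path of the cube of this subset leads from the first point to the
vicinity of the complement. -/
theorem exists_isHamPath_to_complement (hT : ∀ a b, T a b → T b a) (hrefl : ∀ a, T a a)
    {S : Set α} (hS : ConnectedIn T S) (hinf : S.Infinite)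
    (hend : AtMostOneEnd T S) {u v : α} (hu : u ∈ S) (hv : v ∈ S) :
    ∃ A ⊆ S, A.Finite ∧ v ∈ A ∧ ConnectedIn T (S \ A) ∧
      ∃ w l y w', IsHamPath T A u w l ∧ T w w' ∧ T w' y ∧ y ∈ S \ A := by
  obtain ⟨l₀, hl₀, hl₀S, hl₀u, hl₀v⟩ := (hS u hu v hv).exists_isChain hu
  have hu₀ : u ∈ l₀ := List.mem_of_head? hl₀u
  have hv₀ : v ∈ l₀ := List.mem_of_getLast? hl₀v
  let F : Set α := {x | x ∈ l₀}
  have hF : F.Finite := l₀.finite_toSet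
  obtain ⟨U, hUS, hUfin, hU⟩ := hend F hF
  have hUne : U.Nonempty := by
    by_contra h
    rw [Set.not_nonempty_iff_eq_empty] at h
    subst h
    simp only [Set.sdiff_empty] at hUfin
    exact hinf hUfin
  obtain ⟨c, hc⟩ := hUne
  -- Replacing `U` by the whole component containing it makes the finite set `S \ U'` connected:
  -- every other component of `S \ F` touches `F`, whose points are linked along the path `l₀`.
  let U' : Set α := {x | x ∈ S \ F ∧ LinkedIn T (S \ F) x c}
  have hUU' : U ⊆ U' := fun x hx => ⟨hUS hx, (hU x hx c hc).mono hUS⟩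
  have hU' : ConnectedIn T U' := by
    refine connectedIn_of_center hT (c := c) fun x hx => ?_
    exact (hx.2.mono_of_forall hx fun z hz hxz => ⟨hz, (hxz.symm hT).trans hx.2⟩).1
  have hU'S : U' ⊆ S := fun x hx => hx.1.1
  have hcompl : S \ (S \ U') = U' := Set.sdiff_sdiff_cancel_left hU'S
  have hFA : ∀ x ∈ l₀, x ∈ S \ U' := fun x hx => ⟨hl₀S x hx, fun h => h.1.2 hx⟩
  have hA : (S \ U').Finite := hUfin.subset (Set.sdiff_subset_sdiff_right hUU')
  have hAconn : ConnectedIn T (S \ U') := by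
    refine connectedIn_of_center hT (c := u) fun x hx => ?_
    have key : ∀ x ∈ l₀, LinkedIn T (S \ U') x u := fun x hx =>
      (linkedIn_of_isChain hl₀ hFA hl₀u x hx).symm hT
    by_cases hxF : x ∈ F
    · exact key x hxF
    obtain ⟨z, w, hxz, hz, hzw, hw, hwS⟩ := (hS x hx.1 u hu).exists_first_hit hx.1 (B := F) hxF hu₀
    have := hxz.mono_of_forall (S' := S \ U') hx fun y hy hxy =>
      ⟨hy.1, fun hyU => hx.2 ⟨⟨hx.1, hxF⟩, hxy.trans hyU.2⟩⟩
    exact this.1.trans ((LinkedIn.single hzw this.2 (hFA w hw)).trans (key w hw))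
  -- The target `w` is chosen on the boundary, next to a point `y` of `U'`, so that the Hamiltonian
  -- path ends near the complement.
  obtain ⟨w, y, -, hw, hwy, hy, -⟩ :=
    (hS u hu c (hUS hc).1).exists_first_hit hu (B := U') (fun h => h.1.2 hu₀) (hUU' hc)
  obtain ⟨w', l, hww', hl⟩ :=
    exists_isHamPath_of_connectedIn hT hrefl hA hAconn (hFA u hu₀) hw
  refine ⟨S \ U', Set.sdiff_subset, hA, hFA v hv₀, by rwa [hcompl], w', l, y, w, hl, hT _ _ hww', hwy, ?_⟩
  rwa [hcompl]

theorem AtMostOneEnd.diff {S P : Set α} (hS : AtMostOneEnd T S) (hP : P.Finite) :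
    AtMostOneEnd T (S \ P) := by
  intro F hF
  obtain ⟨U, hU, hfin, hconn⟩ := hS (F ∪ P) (hF.union hP)
  exact ⟨U, fun x hx => ⟨⟨(hU hx).1, fun h => (hU hx).2 (Or.inr h)⟩, fun h => (hU hx).2 (Or.inl h)⟩,
    hfin.subset (Set.sdiff_subset_sdiff_left Set.sdiff_subset), hconn⟩

end Connectivity

/-! ### A computable Hamiltonian ray in the one-ended case. -/

section ComputableRay

/-- The finite sets `{b | T a b}` are computable from `a`. -/
def HasNeighborLists (T : ℕ → ℕ → Prop) : Prop :=
  ∃ nb : ℕ → List ℕ, Computable nb ∧ ∀ a b, b ∈ nb a ↔ T a b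

theorem HasNeighborLists.computablePred {T : ℕ → ℕ → Prop} (hT : HasNeighborLists T) :
    ComputablePred fun p : ℕ × ℕ => T p.1 p.2 := by
  obtain ⟨nb, hnb, h⟩ := hT
  exact (ComputablePred.mem_list Computable.snd (hnb.comp Computable.fst)).of_eq fun p => h _ _

theorem HasNeighborLists.comp {T T' : ℕ → ℕ → Prop} (hT : HasNeighborLists T)
    (hT' : HasNeighborLists T') : HasNeighborLists fun a c => ∃ b, T a b ∧ T' b c := by
  obtain ⟨f, hf, h⟩ := hT
  obtain ⟨g, hg, h'⟩ := hT'
  -- The list is searched for: its correctness is decidable, and `flatMap` is needed only for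
  -- existence.
  have : ∃ k : ℕ → List ℕ, Computable k ∧ ∀ a, (∀ b ∈ f a, ∀ c ∈ g b, c ∈ k a) ∧
      ∀ c ∈ k a, ∃ b ∈ f a, c ∈ g b := by
    refine exists_computable_choice (R := fun a (l : List ℕ) => (∀ b ∈ f a, ∀ c ∈ g b, c ∈ l) ∧
      ∀ c ∈ l, ∃ b ∈ f a, c ∈ g b) ?_ ?_
    · refine ComputablePred.and' ?_ ?_
      · refine ComputablePred.forall_mem' (P := fun (p : ℕ × List ℕ) b => ∀ c ∈ g b, c ∈ p.2) ?_
          (hf.comp Computable.fst)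
        refine ComputablePred.forall_mem' (P := fun (p : (ℕ × List ℕ) × ℕ) c => c ∈ p.1.2) ?_
          (hg.comp Computable.snd)
        exact ComputablePred.mem_list Computable.snd
          (Computable.snd.comp (Computable.fst.comp Computable.fst))
      · refine ComputablePred.forall_mem' (P := fun (p : ℕ × List ℕ) c => ∃ b ∈ f p.1, c ∈ g b) ?_
          Computable.snd
        refine ComputablePred.exists_mem' (P := fun (p : (ℕ × List ℕ) × ℕ) b => p.2 ∈ g b) ?_
          (hf.comp (Computable.fst.comp Computable.fst))
        exact ComputablePred.mem_list (Computable.snd.comp Computable.fst)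
          (hg.comp Computable.snd)
    · intro a
      refine ⟨(f a).flatMap g, fun b hb c hc => List.mem_flatMap.2 ⟨b, hb, hc⟩, fun c hc => ?_⟩
      exact List.mem_flatMap.1 hc
  obtain ⟨k, hk, H⟩ := this
  refine ⟨k, hk, fun a c => ⟨fun hc => ?_, ?_⟩⟩
  · obtain ⟨b, hb, hc⟩ := (H a).2 c hc
    exact ⟨b, (h _ _).1 hb, (h' _ _).1 hc⟩
  · rintro ⟨b, hb, hc⟩
    exact (H a).1 b ((h _ _).2 hb) c ((h' _ _).2 hc)

theorem HasNeighborLists.threeStep {T : ℕ → ℕ → Prop} (hT : HasNeighborLists T) :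
    HasNeighborLists (ThreeStep T) := by
  obtain ⟨nb, hnb, h⟩ := hT.comp (hT.comp hT)
  refine ⟨nb, hnb, fun a b => (h a b).trans ?_⟩
  simp only [ThreeStep, exists_and_left]

variable (T : ℕ → ℕ → Prop) (D : Set ℕ)

/-- `P` is a path in the cube of `(D, T)`, whose complement in `D` is connected as witnessed by the
walk `W`, which begins near the end of `P`. -/
structure IsCertifiedPath (P W : List ℕ) : Prop where
  nodup : P.Nodup
  subset : ∀ x ∈ P, x ∈ D
  isChain : P.IsChain (ThreeStep T)
  walk : W.IsChain T
  walk_subset : ∀ x ∈ W, x ∈ D ∧ x ∉ P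
  boundary : ∀ x ∈ P, ∀ y, T x y → y ∈ D → y ∈ P ∨ y ∈ W
  last : ∃ a ∈ P, ∃ b ∈ W, P.getLast? = some a ∧ W.head? = some b ∧ ∃ c, T a c ∧ T c b

variable {T D}

theorem computablePred_isCertifiedPath (hT : HasNeighborLists T)
    (hD : ComputablePred fun n => n ∈ D) :
    ComputablePred fun p : List ℕ × List ℕ => IsCertifiedPath T D p.1 p.2 := by
  have hT2 := (hT.comp hT).computablePred
  obtain ⟨nb, hnb, h⟩ := id hT
  have c1 : ComputablePred fun p : List ℕ × List ℕ => p.1.Nodup :=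
    ComputablePred.nodup Computable.fst
  have c2 : ComputablePred fun p : List ℕ × List ℕ => ∀ x ∈ p.1, x ∈ D :=
    ComputablePred.forall_mem' (P := fun (_ : List ℕ × List ℕ) x => x ∈ D)
      (hD.comp' Computable.snd) Computable.fst
  have c3 : ComputablePred fun p : List ℕ × List ℕ => p.1.IsChain (ThreeStep T) :=
    ComputablePred.isChain hT.threeStep.computablePred Computable.fst
  have c4 : ComputablePred fun p : List ℕ × List ℕ => p.2.IsChain T :=
    ComputablePred.isChain hT.computablePred Computable.snd
  have c5 : ComputablePred fun p : List ℕ × List ℕ => ∀ x ∈ p.2, x ∈ D ∧ x ∉ p.1 :=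
    ComputablePred.forall_mem' (P := fun (p : List ℕ × List ℕ) x => x ∈ D ∧ x ∉ p.1)
      ((hD.comp' Computable.snd).and'
        (ComputablePred.mem_list Computable.snd (Computable.fst.comp Computable.fst)).not)
      Computable.snd
  have c6 : ComputablePred fun p : List ℕ × List ℕ =>
      ∀ x ∈ p.1, ∀ y ∈ nb x, y ∈ D → y ∈ p.1 ∨ y ∈ p.2 := by
    refine ComputablePred.forall_mem'
      (P := fun (p : List ℕ × List ℕ) x => ∀ y ∈ nb x, y ∈ D → y ∈ p.1 ∨ y ∈ p.2) ?_ Computable.fst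
    refine ComputablePred.forall_mem' (P := fun (p : (List ℕ × List ℕ) × ℕ) y =>
      y ∈ D → y ∈ p.1.1 ∨ y ∈ p.1.2) ?_ (hnb.comp Computable.snd)
    have hfst := Computable.fst.comp (Computable.fst (α := (List ℕ × List ℕ) × ℕ) (β := ℕ))
    exact (hD.comp' Computable.snd).imp'
      ((ComputablePred.mem_list Computable.snd (Computable.fst.comp hfst)).or'
        (ComputablePred.mem_list Computable.snd (Computable.snd.comp hfst)))
  have c7 : ComputablePred fun p : List ℕ × List ℕ =>
      ∃ a ∈ p.1, ∃ b ∈ p.2, p.1.getLast? = some a ∧ p.2.head? = some b ∧ ∃ c, T a c ∧ T c b := by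
    have hlast : Computable fun l : List ℕ => l.getLast? :=
      (Primrec.list_head?.to_comp.comp Computable.list_reverse).of_eq fun l => by simp
    refine ComputablePred.exists_mem' (P := fun (p : List ℕ × List ℕ) a => ∃ b ∈ p.2,
      p.1.getLast? = some a ∧ p.2.head? = some b ∧ ∃ c, T a c ∧ T c b) ?_ Computable.fst
    refine ComputablePred.exists_mem' (P := fun (p : (List ℕ × List ℕ) × ℕ) b =>
      p.1.1.getLast? = some p.2 ∧ p.1.2.head? = some b ∧ ∃ c, T p.2 c ∧ T c b) ?_
      (Computable.snd.comp Computable.fst)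
    have hfst := Computable.fst.comp (Computable.fst (α := (List ℕ × List ℕ) × ℕ) (β := ℕ))
    have hsnd := Computable.snd.comp (Computable.fst (α := (List ℕ × List ℕ) × ℕ) (β := ℕ))
    exact (ComputablePred.eq' (hlast.comp (Computable.fst.comp hfst))
        (Computable.option_some.comp hsnd)).and'
      ((ComputablePred.eq' (Primrec.list_head?.to_comp.comp (Computable.snd.comp hfst))
        (Computable.option_some.comp Computable.snd)).and'
        (hT2.comp' (hsnd.pair Computable.snd)))
  refine (c1.and' (c2.and' (c3.and' (c4.and' (c5.and' (c6.and' c7)))))).of_eq fun p => ?_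
  simp only [h]
  exact ⟨fun ⟨h1, h2, h3, h4, h5, h6, h7⟩ => ⟨h1, h2, h3, h4, h5, h6, h7⟩,
    fun ⟨h1, h2, h3, h4, h5, h6, h7⟩ => ⟨h1, h2, h3, h4, h5, h6, h7⟩⟩

/-- A path in `D` from any point of the complement to `P` first meets `P` from a neighbour of `P`,
which lies on `W` by `boundary`; and all points of `W` are linked along it. -/
theorem IsCertifiedPath.connectedIn (hsymm : ∀ a b, T a b → T b a) (hD : ConnectedIn T D)
    {P W : List ℕ} (h : IsCertifiedPath T D P W) : ConnectedIn T (D \ {x | x ∈ P}) := by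
  obtain ⟨a, ha, b, hb, -, hWb, -⟩ := h.last
  refine connectedIn_of_center hsymm (c := b) fun x hx => ?_
  obtain ⟨z, w, hxz, hz, hzw, hw, -⟩ :=
    (hD x hx.1 a (h.subset a ha)).exists_first_hit hx.1 (B := {x | x ∈ P}) hx.2 ha
  have hzW : z ∈ W := (h.boundary w hw z (hsymm _ _ hzw) hz.1).resolve_left hz.2
  exact hxz.trans ((linkedIn_of_isChain h.walk h.walk_subset hWb z hzW).symm hsymm)

/-- The extension `Q` is a Hamiltonian path of a finite piece containing `v` whose removal keeps the
rest connected. The neighbours of `P ++ Q` are finite in number, so a single walk in the rest visits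
all those that lie there. -/
theorem exists_isCertifiedPath_append (hT : HasNeighborLists T) (hsymm : ∀ a b, T a b → T b a)
    (hrefl : ∀ a, T a a) (hinf : D.Infinite) (hend : AtMostOneEnd T D) {P : List ℕ}
    (hP : P.Nodup) (hPD : ∀ x ∈ P, x ∈ D) (hPchain : P.IsChain (ThreeStep T))
    (hconn : ConnectedIn T (D \ {x | x ∈ P})) {u v : ℕ}
    (hu : u ∈ D \ {x | x ∈ P}) (hlast : ∀ a, P.getLast? = some a → ThreeStep T a u)
    (hv : v ∈ D \ {x | x ∈ P}) :
    ∃ Q W, v ∈ Q ∧ IsCertifiedPath T D (P ++ Q) W := by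
  have hPfin : {x | x ∈ P}.Finite := P.finite_toSet
  obtain ⟨A, hA, hAfin, hvA, hcompl, w, l, y, w', hl, hww', hwy, hy⟩ :=
    exists_isHamPath_to_complement hsymm hrefl hconn (hinf.sdiff hPfin) (hend.diff hPfin) hu hv
  obtain ⟨nb, -, hnb⟩ := id hT
  obtain ⟨W, hW, hWS, hWy, hWcov⟩ := hcompl.exists_walk hrefl hy
    (((P ++ l).flatMap nb).filter fun z => @decide (z ∈ (D \ {x | x ∈ P}) \ A) (Classical.dec _))
    (by intro z hz; simpa using (List.mem_filter.1 hz).2)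
  have hlmem : ∀ x, x ∈ l → x ∈ D \ {x | x ∈ P} := fun x hx => hA ((hl.mem_iff x).1 hx)
  refine ⟨l, W, (hl.mem_iff v).2 hvA, ?_⟩
  refine ⟨hP.append hl.nodup fun x hx hx' => (hlmem x hx').2 hx, ?_, ?_, hW, ?_, ?_, ?_⟩
  · intro x hx
    rcases List.mem_append.1 hx with hx | hx
    · exact hPD x hx
    · exact (hlmem x hx).1
  · refine hPchain.append hl.isChain ?_
    intro a ha b hb
    rw [hl.head, Option.mem_def, Option.some.injEq] at hb
    subst hb
    exact hlast a ha
  · intro x hx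
    have := hWS x hx
    refine ⟨this.1.1, fun hx' => ?_⟩
    rcases List.mem_append.1 hx' with hx' | hx'
    · exact this.1.2 hx'
    · exact this.2 ((hl.mem_iff x).1 hx')
  · intro x hx z hxz hz
    by_cases hz' : z ∈ P ++ l
    · exact Or.inl hz'
    refine Or.inr (hWcov z (List.mem_filter.2 ⟨List.mem_flatMap.2 ⟨x, hx, (hnb _ _).2 hxz⟩, ?_⟩))
    rw [List.mem_append, not_or] at hz'
    simpa [hz, hz'.1, ← hl.mem_iff] using hz'.2
  · refine ⟨w, List.mem_append_right _ (List.mem_of_getLast? hl.last), y, List.mem_of_head? hWy, ?_,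
      hWy, w', hww', hwy⟩
    simp [hl.last]

theorem IsCertifiedPath.exists_append (hT : HasNeighborLists T) (hsymm : ∀ a b, T a b → T b a)
    (hrefl : ∀ a, T a a) (hinf : D.Infinite) (hD : ConnectedIn T D) (hend : AtMostOneEnd T D)
    {P W : List ℕ} (h : IsCertifiedPath T D P W) {v : ℕ} (hv : v ∈ D \ {x | x ∈ P}) :
    ∃ Q W, v ∈ Q ∧ IsCertifiedPath T D (P ++ Q) W := by
  obtain ⟨a, ha, b, hb, hPa, hWb, c, hac, hcb⟩ := h.last
  refine exists_isCertifiedPath_append hT hsymm hrefl hinf hend h.nodup h.subset h.isChain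
    (h.connectedIn hsymm hD) (h.walk_subset b hb) (fun a' ha' => ?_) hv
  rw [hPa, Option.some.injEq] at ha'
  subst ha'
  exact ⟨c, b, hac, hcb, hrefl b⟩

/-- A connected decidable set with at most one end has a computable Hamiltonian ray in its cube. -/
theorem exists_computable_ray (hT : HasNeighborLists T) (hsymm : ∀ a b, T a b → T b a)
    (hrefl : ∀ a, T a a) (hDc : ComputablePred fun n => n ∈ D) (hinf : D.Infinite)
    (hD : ConnectedIn T D) (hend : AtMostOneEnd T D) :
    ∃ q : ℕ → ℕ, Computable q ∧ Function.Injective q ∧ Set.range q = D ∧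
      ∀ n, ThreeStep T (q n) (q (n + 1)) := by
  -- A state is a stage number, a path and its certificate. Stage `n` forces `n` onto the path if `n
  -- ∈ D`, which exhausts `D`; strict growth makes every index eventually defined.
  let R : ℕ × List ℕ × List ℕ → ℕ × List ℕ × List ℕ → Prop := fun s t =>
    t.1 = s.1 + 1 ∧ t.2.1.take s.2.1.length = s.2.1 ∧ s.2.1.length < t.2.1.length ∧
      (s.1 ∈ D → s.1 ∈ t.2.1) ∧ IsCertifiedPath T D t.2.1 t.2.2
  have hR : ComputablePred fun p : (ℕ × List ℕ × List ℕ) × (ℕ × List ℕ × List ℕ) => R p.1 p.2 := by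
    have hs1 : Computable fun p : (ℕ × List ℕ × List ℕ) × (ℕ × List ℕ × List ℕ) => p.1.1 :=
      Computable.fst.comp Computable.fst
    have hs2 : Computable fun p : (ℕ × List ℕ × List ℕ) × (ℕ × List ℕ × List ℕ) => p.1.2.1 :=
      Computable.fst.comp (Computable.snd.comp Computable.fst)
    have ht1 : Computable fun p : (ℕ × List ℕ × List ℕ) × (ℕ × List ℕ × List ℕ) => p.2.1 :=
      Computable.fst.comp Computable.snd
    have ht2 : Computable fun p : (ℕ × List ℕ × List ℕ) × (ℕ × List ℕ × List ℕ) => p.2.2.1 :=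
      Computable.fst.comp (Computable.snd.comp Computable.snd)
    exact (ComputablePred.eq' ht1 (Computable.succ.comp hs1)).and'
      ((ComputablePred.eq' (Primrec.list_take.to_comp.comp (Computable.list_length.comp hs2) ht2)
        hs2).and'
      ((ComputablePred.lt' (Computable.list_length.comp hs2) (Computable.list_length.comp ht2)).and'
      (((hDc.comp' hs1).imp' (ComputablePred.mem_list hs1 ht2)).and'
      ((computablePred_isCertifiedPath hT hDc).comp' (Computable.snd.comp Computable.snd)))))
  obtain ⟨x₀, hx₀⟩ := hinf.nonempty
  obtain ⟨P₀, W₀, -, h₀⟩ := exists_isCertifiedPath_append (P := []) hT hsymm hrefl hinf hend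
    (by simp) (by simp) (by simp) (by simpa using hD) (u := x₀) (v := x₀) (by simpa) (by simp)
    (by simpa)
  obtain ⟨s, hs, hs0, hsI, hsR⟩ := exists_computable_seq hR
    (I := fun s => IsCertifiedPath T D s.2.1 s.2.2) (a₀ := (0, P₀, W₀)) h₀ (by
      rintro ⟨n, P, W⟩ h
      -- When `n` needs no insertion, any new point serves, since the path must still grow.
      obtain ⟨v, hv, hnv⟩ : ∃ v, v ∈ D \ {x | x ∈ P} ∧ (n ∈ D → n ∈ P ∨ n = v) := by
        by_cases hn : n ∈ D \ {x | x ∈ P}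
        · exact ⟨n, hn, fun _ => Or.inr rfl⟩
        · obtain ⟨v, hv⟩ := (hinf.sdiff P.finite_toSet).nonempty
          exact ⟨v, hv, fun h => Or.inl (by_contra fun h' => hn ⟨h, h'⟩)⟩
      obtain ⟨Q, W', hvQ, hW'⟩ := h.exists_append hT hsymm hrefl hinf hD hend hv
      refine ⟨(n + 1, P ++ Q, W'), rfl, by simp, ?_, ?_, hW'⟩
      · simpa using List.length_pos_of_mem hvQ
      · intro hn
        rcases hnv hn with h | rfl
        · exact List.mem_append_left _ h
        · exact List.mem_append_right _ hvQ)
    fun _ _ _ h => h.2.2.2.2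
  have hlen : ∀ n, n ≤ (s n).2.1.length := by
    intro n
    induction n with
    | zero => simp
    | succ n ih => exact ih.trans_lt (hsR n).2.2.1
  have hs1 : ∀ n, (s n).1 = n := by
    intro n
    induction n with
    | zero => simp [hs0]
    | succ n ih => rw [(hsR n).1, ih]
  have hprefix : ∀ m n, m ≤ n → (s m).2.1 <+: (s n).2.1 := by
    intro m n hmn
    induction n, hmn using Nat.le_induction with
    | base => exact List.prefix_rfl
    | succ n _ ih =>
      refine ih.trans ?_
      rw [← (hsR n).2.1]
      exact List.take_prefix _ _
  -- After `k + 1` stages the path has more than `k` entries, and later stages only extend it, so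
  -- entry `k` is final.
  let q : ℕ → ℕ := fun k => (s (k + 1)).2.1.getD k 0
  have hq : ∀ k n (h : k < (s n).2.1.length), q k = (s n).2.1[k] := by
    intro k n h
    have h' : k < (s (k + 1)).2.1.length := hlen (k + 1)
    change (s (k + 1)).2.1.getD k 0 = _
    rw [List.getD_eq_getElem _ _ h']
    rcases le_total n (k + 1) with hn | hn
    · exact ((hprefix _ _ hn).getElem h).symm
    · exact (hprefix _ _ hn).getElem h'
  refine ⟨q, ?_, ?_, ?_, ?_⟩
  · exact (Primrec.list_getD 0).to_comp.comp (Computable.fst.comp (Computable.snd.comp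
      (hs.comp Computable.succ))) Computable.id
  · intro i j hij
    have hi : i < (s (max i j + 1)).2.1.length := lt_of_lt_of_le (by omega) (hlen _)
    have hj : j < (s (max i j + 1)).2.1.length := lt_of_lt_of_le (by omega) (hlen _)
    rw [hq i _ hi, hq j _ hj] at hij
    exact (hsI _).nodup.getElem_inj_iff.1 hij
  · ext x
    constructor
    · rintro ⟨k, rfl⟩
      rw [hq k (k + 1) (hlen _)]
      exact (hsI _).subset _ (List.getElem_mem _)
    · intro hx
      have hx' : (s x).1 ∈ (s (x + 1)).2.1 := (hsR x).2.2.2.1 (by rwa [hs1])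
      rw [hs1] at hx'
      obtain ⟨k, hk, hkx⟩ := List.mem_iff_getElem.1 hx'
      exact ⟨k, (hq _ _ hk).trans hkx⟩
  · intro k
    have h1 : k + 1 < (s (k + 2)).2.1.length := hlen (k + 2)
    rw [hq (k + 1) (k + 2) h1, hq k (k + 2) (by omega)]
    exact List.isChain_iff_getElem.1 (hsI (k + 2)).isChain k h1

end ComputableRay

/-! ### From rays to lines, and the two-ended case. -/

section TwoSided

theorem ComputablePred.mem_finite {F : Set ℕ} (hF : F.Finite) :
    ComputablePred fun n => n ∈ F :=
  (ComputablePred.mem_list Computable.id (Computable.const hF.toFinset.toList)).of_eq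
    fun n => by simp

theorem SimpleGraph.edist_le_succ_iff {V : Type*} {H : SimpleGraph V} {a b : V} {k : ℕ} :
    H.edist a b ≤ (k + 1 : ℕ) ↔ ∃ c, H.edist a c ≤ 1 ∧ H.edist c b ≤ k := by
  constructor
  · intro h
    obtain ⟨w, hw⟩ := SimpleGraph.exists_walk_of_edist_ne_top
      (ne_top_of_le_ne_top (ENat.natCast_ne_top _) h)
    rw [← hw, Nat.cast_le] at h
    cases w with
    | nil => exact ⟨a, by simp, by simp⟩
    | @cons _ c _ hac w =>
      refine ⟨c, SimpleGraph.edist_le_one_iff_adj_or_eq.2 (Or.inl hac),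
        (SimpleGraph.edist_le w).trans ?_⟩
      rw [SimpleGraph.Walk.length_cons] at h
      exact_mod_cast Nat.le_of_succ_le_succ h
  · rintro ⟨c, h1, h2⟩
    refine SimpleGraph.edist_triangle.trans ((add_le_add h1 h2).trans ?_)
    rw [add_comm]
    simp

variable {H : SimpleGraph ℕ}

theorem HasNeighborLists.edist_le (hH : HasNeighborLists H.Adj) (k : ℕ) :
    HasNeighborLists fun a b => H.edist a b ≤ k := by
  induction k with
  | zero =>
    refine ⟨fun a => [a], Computable.list_cons.comp Computable.id (Computable.const []), ?_⟩
    intro a b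
    simp [SimpleGraph.edist_eq_zero_iff, eq_comm (a := a)]
  | succ k ih =>
    have h1 : HasNeighborLists fun a b => H.edist a b ≤ 1 := by
      obtain ⟨nb, hnb, h⟩ := hH
      refine ⟨fun a => a :: nb a, Computable.list_cons.comp Computable.id hnb, fun a b => ?_⟩
      change b ∈ a :: nb a ↔ H.edist a b ≤ 1
      rw [SimpleGraph.edist_le_one_iff_adj_or_eq, List.mem_cons, h, or_comm, eq_comm]
    obtain ⟨nb, hnb, h⟩ := h1.comp ih
    exact ⟨nb, hnb, fun a b => (h a b).trans SimpleGraph.edist_le_succ_iff.symm⟩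

theorem edist_le_of_threeStep {C a b : ℕ} (h : ThreeStep (fun a b => H.edist a b ≤ C) a b) :
    H.edist a b ≤ (3 * C : ℕ) := by
  obtain ⟨c, d, h1, h2, h3⟩ := h
  calc H.edist a b ≤ H.edist a c + H.edist c b := SimpleGraph.edist_triangle
    _ ≤ H.edist a c + (H.edist c d + H.edist d b) := by gcongr; exact SimpleGraph.edist_triangle
    _ ≤ C + (C + C) := by gcongr
    _ = (3 * C : ℕ) := by push_cast; ring

/-- `D` is the set of vertices of a computable injective sequence with bounded jumps. -/
def HasBoundedRay (H : SimpleGraph ℕ) (D : Set ℕ) : Prop :=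
  ∃ q : ℕ → ℕ, Computable q ∧ Function.Injective q ∧ Set.range q = D ∧
    ∃ C : ℕ, ∀ n, H.edist (q n) (q (n + 1)) ≤ C

/-- The new point goes in front; this creates a single new jump, of finite length. -/
theorem HasBoundedRay.insert {D : Set ℕ} (hD : HasBoundedRay H D) {x : ℕ} (hx : x ∉ D)
    (hfin : ∀ y ∈ D, H.edist x y ≠ ⊤) : HasBoundedRay H (insert x D) := by
  obtain ⟨q, hq, hinj, hrange, C, hC⟩ := hD
  have hmem : ∀ n, q n ∈ D := fun n => hrange ▸ Set.mem_range_self n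
  refine ⟨fun n => Nat.casesOn n x q, ?_, ?_, ?_, max C (H.edist x (q 0)).toNat, ?_⟩
  · exact Computable.nat_casesOn Computable.id (Computable.const x) (hq.comp Computable.snd)
  · rintro (_ | i) (_ | j) hij
    · rfl
    · exact absurd (hmem j) (by rwa [← show x = q j from hij])
    · exact absurd (hmem i) (by rwa [show q i = x from hij])
    · rw [hinj (show q i = q j from hij)]
  · ext y
    rw [Set.mem_insert_iff, ← hrange]
    constructor
    · rintro ⟨_ | i, rfl⟩
      · exact Or.inl rfl
      · exact Or.inr ⟨i, rfl⟩
    · rintro (rfl | ⟨i, rfl⟩)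
      · exact ⟨0, rfl⟩
      · exact ⟨i + 1, rfl⟩
  · rintro (_ | i)
    · change H.edist x (q 0) ≤ _
      nth_rewrite 1 [← ENat.natCast_toNat (hfin _ (hmem 0))]
      exact Nat.cast_le.2 (le_max_right _ _)
    · exact (hC i).trans (by exact_mod_cast le_max_left _ _)

theorem HasBoundedRay.union_finite {D E : Set ℕ} (hD : HasBoundedRay H D) (hE : E.Finite)
    (hDE : Disjoint E D) (hfin : ∀ x ∈ E ∪ D, ∀ y ∈ E ∪ D, H.edist x y ≠ ⊤) :
    HasBoundedRay H (E ∪ D) := by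
  induction E, hE using Set.Finite.induction_on with
  | empty => simpa using hD
  | @insert a s ha hs ih =>
    rw [Set.insert_union] at hfin ⊢
    rw [Set.disjoint_insert_left] at hDE
    refine (ih hDE.2 fun x hx y hy => hfin x (Or.inr hx) y (Or.inr hy)).insert ?_ ?_
    · rintro (h | h)
      · exact ha h
      · exact hDE.1 h
    · exact fun y hy => hfin a (Or.inl rfl) y (Or.inr hy)

/-- `D` is the set of vertices of a computable injective sequence in which the terms of even index
and the terms of odd index have bounded jumps. -/
def HasBoundedLine (H : SimpleGraph ℕ) (D : Set ℕ) : Prop :=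
  ∃ q : ℕ → ℕ, Computable q ∧ Function.Injective q ∧ Set.range q = D ∧
    ∃ C : ℕ, ∀ n, H.edist (q n) (q (n + 2)) ≤ C

/-- The ray is folded: even and odd terms become the two halves of the line, and each jump there is
two steps of the ray. -/
theorem HasBoundedRay.hasBoundedLine {D : Set ℕ} (hD : HasBoundedRay H D) : HasBoundedLine H D := by
  obtain ⟨q, hq, hinj, hrange, C, hC⟩ := hD
  refine ⟨q, hq, hinj, hrange, C + C, fun n => ?_⟩
  rw [Nat.cast_add]
  exact SimpleGraph.edist_triangle.trans (add_le_add (hC n) (hC (n + 1)))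

theorem HasBoundedRay.union {D E : Set ℕ} (hD : HasBoundedRay H D) (hE : HasBoundedRay H E)
    (hDE : Disjoint D E) : HasBoundedLine H (D ∪ E) := by
  obtain ⟨q, hq, hinj, hrange, C, hC⟩ := hD
  obtain ⟨r, hr, hinj', hrange', C', hC'⟩ := hE
  have hqr : ∀ i j, q i ≠ r j := fun i j h =>
    Set.disjoint_left.1 hDE (hrange ▸ Set.mem_range_self i) (h ▸ hrange' ▸ Set.mem_range_self j)
  have h0 : ∀ n, (bif (2 * n).bodd then r (2 * n).div2 else q (2 * n).div2) = q n := by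
    intro n; simp [Nat.div2_val]
  have h1 : ∀ n, (bif (2 * n + 1).bodd then r (2 * n + 1).div2 else q (2 * n + 1).div2) = r n := by
    intro n
    simp [Nat.div2_val]
  refine ⟨fun n => bif n.bodd then r n.div2 else q n.div2, ?_, ?_, ?_, max C C', ?_⟩
  · exact Computable.cond Computable.nat_bodd (hr.comp Computable.nat_div2)
      (hq.comp Computable.nat_div2)
  · intro i j hij
    obtain ⟨i, rfl | rfl⟩ := i.even_or_odd' <;> obtain ⟨j, rfl | rfl⟩ := j.even_or_odd' <;>
      simp only [h0, h1] at hij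
    · rw [hinj hij]
    · exact absurd hij (hqr _ _)
    · exact absurd hij.symm (hqr _ _)
    · rw [hinj' hij]
  · ext y
    rw [← hrange, ← hrange']
    constructor
    · rintro ⟨n, rfl⟩
      obtain ⟨n, rfl | rfl⟩ := n.even_or_odd'
      · exact Or.inl ⟨n, (h0 n).symm⟩
      · exact Or.inr ⟨n, (h1 n).symm⟩
    · rintro (⟨n, rfl⟩ | ⟨n, rfl⟩)
      · exact ⟨2 * n, h0 n⟩
      · exact ⟨2 * n + 1, h1 n⟩
  · intro n
    obtain ⟨n, rfl | rfl⟩ := n.even_or_odd'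
    · rw [show 2 * n + 2 = 2 * (n + 1) by ring]
      simp only [h0]
      exact (hC n).trans (by exact_mod_cast le_max_left _ _)
    · rw [show 2 * n + 1 + 2 = 2 * (n + 1) + 1 by ring]
      simp only [h1]
      exact (hC' n).trans (by exact_mod_cast le_max_right _ _)

/-! ### Components: ends and decidability. -/

section Component

variable {T : ℕ → ℕ → Prop} {D F : Set ℕ}

/-- The component of `c` in `S`. -/
def componentIn (T : ℕ → ℕ → Prop) (S : Set ℕ) (c : ℕ) : Set ℕ :=
  {x | x ∈ S ∧ LinkedIn T S x c}

theorem connectedIn_componentIn (hsymm : ∀ a b, T a b → T b a) (S : Set ℕ) (c : ℕ) :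
    ConnectedIn T (componentIn T S c) := by
  refine connectedIn_of_center hsymm (c := c) fun x hx => ?_
  exact (hx.2.mono_of_forall hx fun z hz hxz => ⟨hz, (hxz.symm hsymm).trans hx.2⟩).1

theorem linkedIn_of_ray {S : Set ℕ} {r : ℕ → ℕ} (hr : ∀ n, T (r n) (r (n + 1))) {m : ℕ}
    (hrS : ∀ n, m ≤ n → r n ∈ S) {n : ℕ} (hmn : m ≤ n) : LinkedIn T S (r m) (r n) := by
  induction n, hmn using Nat.le_induction with
  | base => exact LinkedIn.refl _
  | succ n h ih => exact ih.trans (LinkedIn.single (hr n) (hrS n h) (hrS _ (by omega)))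

/-- A tail of the ray beyond the given finite set is connected and cofinite in `S`. -/
theorem atMostOneEnd_of_ray (hsymm : ∀ a b, T a b → T b a) {S : Set ℕ} {r : ℕ → ℕ}
    (hinj : Function.Injective r) (hr : ∀ n, T (r n) (r (n + 1))) (hrS : ∀ n, r n ∈ S)
    (hfin : (S \ Set.range r).Finite) : AtMostOneEnd T S := by
  intro F hF
  obtain ⟨M, hM⟩ := (hF.preimage hinj.injOn).bddAbove
  refine ⟨r '' Set.Ici (M + 1), ?_, ?_, ?_⟩
  · rintro _ ⟨n, hn, rfl⟩
    refine ⟨hrS n, fun h => ?_⟩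
    have := hM h
    rw [Set.mem_Ici] at hn
    omega
  · refine (hfin.union ((Set.finite_Iio (M + 1)).image r)).subset ?_
    rintro x ⟨hx, hx'⟩
    by_cases h : x ∈ Set.range r
    · obtain ⟨n, rfl⟩ := h
      refine Or.inr ⟨n, ?_, rfl⟩
      by_contra hn
      exact hx' ⟨n, Set.mem_Ici.2 (not_lt.1 hn), rfl⟩
    · exact Or.inl ⟨hx, h⟩
  · refine connectedIn_of_center hsymm (c := r (M + 1)) ?_
    rintro _ ⟨n, hn, rfl⟩
    exact (linkedIn_of_ray (S := r '' Set.Ici (M + 1)) hr (fun k hk => ⟨k, hk, rfl⟩) hn).symm hsymm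

/-- If the components of `a` and `b` cover a cofinite set, then they are decidable. -/
theorem computablePred_componentIn (hT : HasNeighborLists T)
    (hD : ComputablePred fun n => n ∈ D) (hF : F.Finite) {a b : ℕ}
    (hfin : (D \ (componentIn T (D \ F) a ∪ componentIn T (D \ F) b)).Finite)
    (hdisj : Disjoint (componentIn T (D \ F) a) (componentIn T (D \ F) b)) :
    ComputablePred fun n => n ∈ componentIn T (D \ F) a := by
  classical
  set A := componentIn T (D \ F) a
  set B := componentIn T (D \ F) b
  have hE : ComputablePred fun n => n ∈ D ∧ n ∉ D \ (A ∪ B) :=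
    hD.and' (ComputablePred.mem_finite hfin).not
  have hlast : Computable fun l : List ℕ => l.getLast? :=
    (Primrec.list_head?.to_comp.comp Computable.list_reverse).of_eq fun l => by simp
  -- For a point of `A ∪ B`, search for a path to `a` or `b` avoiding `F`; as the components are
  -- disjoint, its endpoint decides membership. Elsewhere any list is accepted, which keeps the
  -- search total.
  obtain ⟨w, hw, hw'⟩ := exists_computable_choice (R := fun x (W : List ℕ) =>
      (x ∈ D ∧ x ∉ D \ (A ∪ B)) → W.IsChain T ∧ (∀ z ∈ W, z ∈ D ∧ z ∉ F) ∧ W.head? = some x ∧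
        (W.getLast? = some a ∨ W.getLast? = some b)) (by
      refine (hE.comp' Computable.fst).imp' (ComputablePred.and' ?_ (ComputablePred.and' ?_
        (ComputablePred.and' ?_ (ComputablePred.or' ?_ ?_))))
      · exact ComputablePred.isChain hT.computablePred Computable.snd
      · exact ComputablePred.forall_mem' (P := fun (_ : ℕ × List ℕ) z => z ∈ D ∧ z ∉ F)
          ((hD.and' (ComputablePred.mem_finite hF).not).comp' Computable.snd) Computable.snd
      · exact ComputablePred.eq' (Primrec.list_head?.to_comp.comp Computable.snd)
          (Computable.option_some.comp Computable.fst)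
      · exact ComputablePred.eq' (hlast.comp Computable.snd) (Computable.const _)
      · exact ComputablePred.eq' (hlast.comp Computable.snd) (Computable.const _)) (by
      intro x
      by_cases hx : x ∈ D ∧ x ∉ D \ (A ∪ B)
      · have hxAB : x ∈ A ∪ B := by_contra fun h => hx.2 ⟨hx.1, h⟩
        rcases hxAB with h | h
        · obtain ⟨W, h1, h2, h3, h4⟩ := h.2.exists_isChain h.1
          exact ⟨W, fun _ => ⟨h1, h2, h3, Or.inl h4⟩⟩
        · obtain ⟨W, h1, h2, h3, h4⟩ := h.2.exists_isChain h.1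
          exact ⟨W, fun _ => ⟨h1, h2, h3, Or.inr h4⟩⟩
      · exact ⟨[], fun h => absurd h hx⟩)
  have hlink : ∀ x, x ∈ D ∧ x ∉ D \ (A ∪ B) → ∀ c, (w x).getLast? = some c →
      x ∈ componentIn T (D \ F) c := by
    intro x hx c hc
    obtain ⟨h1, h2, h3, -⟩ := hw' x hx
    exact ⟨h2 x (List.mem_of_head? h3), linkedIn_of_isChain h1 h2 h3 c (List.mem_of_getLast? hc)⟩
  refine (hE.and' (ComputablePred.eq' (hlast.comp hw) (Computable.const (some a)))).of_eq
    fun x => ⟨fun h => hlink x h.1 a h.2, fun h => ?_⟩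
  have hx : x ∈ D ∧ x ∉ D \ (A ∪ B) := ⟨h.1.1, fun h' => h'.2 (Or.inl h)⟩
  refine ⟨hx, (hw' x hx).2.2.2.resolve_right fun h' => ?_⟩
  exact Set.disjoint_left.1 hdisj h (hlink x hx b h')

end Component

theorem hasBoundedRay_of_atMostOneEnd (hH : HasNeighborLists H.Adj) {D : Set ℕ}
    (hD : ComputablePred fun n => n ∈ D) (hinf : D.Infinite) {C : ℕ}
    (hconn : ConnectedIn (fun a b => H.edist a b ≤ C) D)
    (hend : AtMostOneEnd (fun a b => H.edist a b ≤ C) D) : HasBoundedRay H D := by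
  obtain ⟨q, hq, hinj, hrange, hstep⟩ := exists_computable_ray (hH.edist_le C)
    (fun a b h => by rwa [SimpleGraph.edist_comm]) (fun a => by simp) hD hinf hconn hend
  exact ⟨q, hq, hinj, hrange, 3 * C, fun n => edist_le_of_threeStep (hstep n)⟩

theorem edist_le_mul_of_step {V : Type*} {H : SimpleGraph V} {p : ℤ → V} {C : ℕ}
    (hp : ∀ i, H.edist (p i) (p (i + 1)) ≤ C) (i : ℤ) (n : ℕ) :
    H.edist (p i) (p (i + n)) ≤ (n * C : ℕ) := by
  induction n with
  | zero => simp
  | succ n ih =>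
    rw [Nat.succ_mul, Nat.cast_add (n * C), Nat.cast_succ, ← add_assoc]
    exact SimpleGraph.edist_triangle.trans (add_le_add ih (hp (i + n)))

theorem hasBoundedLine_of_int (hH : HasNeighborLists H.Adj) {D : Set ℕ}
    (hD : ComputablePred fun n => n ∈ D) {p : ℤ → ℕ} (hinj : Function.Injective p)
    (hrange : Set.range p = D) {C : ℕ} (hp : ∀ i, H.edist (p i) (p (i + 1)) ≤ C) :
    HasBoundedLine H D := by
  let T : ℕ → ℕ → Prop := fun a b => H.edist a b ≤ C
  have hT : HasNeighborLists T := hH.edist_le C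
  have hsymm : ∀ a b, T a b → T b a := fun a b h => by
    change H.edist b a ≤ C
    rwa [SimpleGraph.edist_comm]
  have hpD : ∀ i, p i ∈ D := fun i => hrange ▸ Set.mem_range_self i
  have hinf : D.Infinite := hrange ▸ Set.infinite_range_of_injective hinj
  have hne : ∀ x ∈ D, ∀ y ∈ D, H.edist x y ≠ ⊤ := by
    rw [← hrange]
    rintro _ ⟨i, rfl⟩ _ ⟨j, rfl⟩
    rcases le_total i j with h | h
    · obtain ⟨n, rfl⟩ := Int.le.dest h
      exact ne_top_of_le_ne_top (ENat.natCast_ne_top _) (edist_le_mul_of_step hp i n)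
    · obtain ⟨n, rfl⟩ := Int.le.dest h
      rw [SimpleGraph.edist_comm]
      exact ne_top_of_le_ne_top (ENat.natCast_ne_top _) (edist_le_mul_of_step hp j n)
  have hup : ∀ N : ℤ, ∀ n : ℕ, T (p (N + n)) (p (N + (n + 1 : ℕ))) := fun N n => by
    have := hp (N + n)
    push_cast
    rwa [← add_assoc]
  have hdown : ∀ N : ℤ, ∀ n : ℕ, T (p (-N - n)) (p (-N - (n + 1 : ℕ))) := fun N n => by
    refine hsymm _ _ ?_
    have := hp (-N - (n + 1 : ℕ))
    rwa [show -N - ((n + 1 : ℕ) : ℤ) + 1 = -N - n by push_cast; ring] at this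
  have hconn : ConnectedIn T D := by
    refine connectedIn_of_center hsymm (c := p 0) fun x hx => ?_
    rw [← hrange] at hx
    obtain ⟨i, rfl⟩ := hx
    refine LinkedIn.symm hsymm ?_
    obtain ⟨n, rfl | rfl⟩ := i.eq_nat_or_neg
    · have := linkedIn_of_ray (T := T) (S := D) (hup 0) (fun k _ => hpD _) (Nat.zero_le n)
      simpa using this
    · have := linkedIn_of_ray (T := T) (S := D) (hdown 0) (fun k _ => hpD _) (Nat.zero_le n)
      simpa using this
  by_cases hend : AtMostOneEnd T D
  · exact (hasBoundedRay_of_atMostOneEnd hH hD hinf hconn hend).hasBoundedLine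
  unfold AtMostOneEnd at hend
  push Not at hend
  obtain ⟨F, hF, hFU⟩ := hend
  -- Beyond `N` both tails of `p` avoid `F`, so each lies in one component of `D \ F`.
  obtain ⟨N, hN⟩ : ∃ N : ℕ, ∀ i : ℤ, N ≤ i.natAbs → p i ∉ F := by
    obtain ⟨M, hM⟩ := ((hF.preimage hinj.injOn).image Int.natAbs).bddAbove
    refine ⟨M + 1, fun i hi h => ?_⟩
    have := hM ⟨i, h, rfl⟩
    omega
  let r₁ : ℕ → ℕ := fun n => p ((N : ℤ) + n)
  let r₂ : ℕ → ℕ := fun n => p (-(N : ℤ) - n)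
  have hr₁ : ∀ n, r₁ n ∈ D \ F := fun n => ⟨hpD _, hN _ (by omega)⟩
  have hr₂ : ∀ n, r₂ n ∈ D \ F := fun n => ⟨hpD _, hN _ (by omega)⟩
  have hinj₁ : Function.Injective r₁ := fun i j h => by have := hinj h; omega
  have hinj₂ : Function.Injective r₂ := fun i j h => by have := hinj h; omega
  set A := componentIn T (D \ F) (r₁ 0) with hA
  set B := componentIn T (D \ F) (r₂ 0) with hB
  have hAD : A ⊆ D := fun x hx => hx.1.1
  have hBD : B ⊆ D := fun x hx => hx.1.1
  have hr₁A : ∀ n, r₁ n ∈ A := fun n => ⟨hr₁ n,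
    (linkedIn_of_ray (T := T) (hup N) (fun k _ => hr₁ k) (Nat.zero_le n)).symm hsymm⟩
  have hr₂B : ∀ n, r₂ n ∈ B := fun n => ⟨hr₂ n,
    (linkedIn_of_ray (T := T) (hdown N) (fun k _ => hr₂ k) (Nat.zero_le n)).symm hsymm⟩
  have hcover : (D \ (Set.range r₁ ∪ Set.range r₂)).Finite := by
    refine ((Set.finite_Icc (-(N : ℤ)) N).image p).subset ?_
    rintro x ⟨hx, hx'⟩
    rw [← hrange] at hx
    obtain ⟨i, rfl⟩ := hx
    refine ⟨i, ?_, rfl⟩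
    by_contra hi
    rw [Set.mem_Icc, not_and_or, not_le, not_le] at hi
    refine hx' ?_
    rcases hi with hi | hi
    · exact Or.inr ⟨(-N - i).toNat, congrArg p (by omega)⟩
    · exact Or.inl ⟨(i - N).toNat, congrArg p (by omega)⟩
  -- If the components met, `A` would contain both tails and be a connected cofinite subset of `D \
  -- F`, against the choice of `F`.
  have hdisj : Disjoint A B := by
    rw [Set.disjoint_left]
    intro x hxA hxB
    have hBA : ∀ y ∈ B, y ∈ A := fun y hy =>
      ⟨hy.1, hy.2.trans ((hxB.2.symm hsymm).trans hxA.2)⟩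
    refine hFU A (fun x hx => hx.1) (hcover.subset (Set.sdiff_subset_sdiff_right ?_))
      (connectedIn_componentIn hsymm _ _)
    rintro _ (⟨n, rfl⟩ | ⟨n, rfl⟩)
    · exact hr₁A n
    · exact hBA _ (hr₂B n)
  have hE : (D \ (A ∪ B)).Finite := by
    refine hcover.subset (Set.sdiff_subset_sdiff_right ?_)
    rintro _ (⟨n, rfl⟩ | ⟨n, rfl⟩)
    · exact Or.inl (hr₁A n)
    · exact Or.inr (hr₂B n)
  have hArange : (A \ Set.range r₁).Finite := hcover.subset fun x hx => ⟨hAD hx.1, by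
    rintro (h | ⟨n, rfl⟩)
    · exact hx.2 h
    · exact Set.disjoint_left.1 hdisj hx.1 (hr₂B n)⟩
  have hBrange : (B \ Set.range r₂).Finite := hcover.subset fun x hx => ⟨hBD hx.1, by
    rintro (⟨n, rfl⟩ | h)
    · exact Set.disjoint_left.1 hdisj (hr₁A n) hx.1
    · exact hx.2 h⟩
  have hArec : ComputablePred fun n => n ∈ A := computablePred_componentIn hT hD hF hE hdisj
  have hBrec : ComputablePred fun n => n ∈ B :=
    computablePred_componentIn hT hD hF (by rwa [Set.union_comm]) hdisj.symm
  have hAray : HasBoundedRay H A := hasBoundedRay_of_atMostOneEnd hH hArec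
    ((Set.infinite_range_of_injective hinj₁).mono (Set.range_subset_iff.2 hr₁A))
    (connectedIn_componentIn hsymm _ _) (atMostOneEnd_of_ray hsymm hinj₁ (hup N) hr₁A hArange)
  have hBray : HasBoundedRay H B := hasBoundedRay_of_atMostOneEnd hH hBrec
    ((Set.infinite_range_of_injective hinj₂).mono (Set.range_subset_iff.2 hr₂B))
    (connectedIn_componentIn hsymm _ _) (atMostOneEnd_of_ray hsymm hinj₂ (hdown N) hr₂B hBrange)
  have hEA : (D \ (A ∪ B)) ∪ A ⊆ D := Set.union_subset Set.sdiff_subset hAD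
  have hEAray := hAray.union_finite hE
    (Set.disjoint_left.2 fun x hx hxA => hx.2 (Or.inl hxA))
    fun x hx y hy => hne x (hEA hx) y (hEA hy)
  have hunion : (D \ (A ∪ B)) ∪ A ∪ B = D := by
    rw [Set.union_assoc, Set.sdiff_union_of_subset (Set.union_subset hAD hBD)]
  rw [← hunion]
  refine hEAray.union hBray (Set.disjoint_left.2 ?_)
  rintro x (hx | hx) hxB
  · exact hx.2 (Or.inr hxB)
  · exact Set.disjoint_left.1 hdisj hx hxB

end TwoSided

/-! ### Passing from a numbered graph to the graph of names. -/

section Transfer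

theorem SimpleGraph.Hom.edist_le {V W : Type*} {G : SimpleGraph V} {G' : SimpleGraph W}
    (f : G →g G') (a b : V) : G'.edist (f a) (f b) ≤ G.edist a b := by
  by_cases h : G.edist a b = ⊤
  · simp [h]
  · obtain ⟨w, hw⟩ := SimpleGraph.exists_walk_of_edist_ne_top h
    rw [← hw, ← SimpleGraph.Walk.length_map f w]
    exact SimpleGraph.edist_le _

variable {V : Type u} (Γ : SimpleGraph V) (ν : BijNumbering V)

/-- The name of an element of a numbered set. -/
def BijNumbering.name (x : V) : ℕ := ν.toEquiv.symm x

theorem BijNumbering.name_mem (x : V) : ν.name x ∈ ν.dom := (ν.toEquiv.symm x).2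

theorem BijNumbering.name_injective : Function.Injective ν.name :=
  Subtype.val_injective.comp ν.toEquiv.symm.injective

theorem BijNumbering.toEquiv_name (x : V) : ν.toEquiv ⟨ν.name x, ν.name_mem x⟩ = x :=
  ν.toEquiv.apply_symm_apply x

theorem BijNumbering.name_toEquiv (n : ν.dom) : ν.name (ν.toEquiv n) = n :=
  congrArg Subtype.val (ν.toEquiv.symm_apply_apply n)

theorem BijNumbering.range_name : Set.range ν.name = ν.dom := by
  ext n
  exact ⟨fun ⟨x, hx⟩ => hx ▸ ν.name_mem x, fun h => ⟨ν.toEquiv ⟨n, h⟩, ν.name_toEquiv ⟨n, h⟩⟩⟩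

/-- The graph on the names of the vertices of `Γ`; natural numbers which are not names are
isolated. -/
def nameGraph : SimpleGraph ℕ where
  Adj a b := ∃ x y, ν.name x = a ∧ ν.name y = b ∧ Γ.Adj x y
  symm := ⟨fun _ _ ⟨x, y, hx, hy, h⟩ => ⟨y, x, hy, hx, h.symm⟩⟩
  loopless := ⟨fun a ⟨x, y, hx, hy, h⟩ => by
    rw [ν.name_injective (hx.trans hy.symm)] at h
    exact h.ne rfl⟩

variable {Γ ν}

theorem nameGraph_adj_name {x y : V} : (nameGraph Γ ν).Adj (ν.name x) (ν.name y) ↔ Γ.Adj x y := by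
  constructor
  · rintro ⟨x', y', hx, hy, h⟩
    rwa [← ν.name_injective hx, ← ν.name_injective hy]
  · exact fun h => ⟨x, y, rfl, rfl, h⟩

/-- The naming map and a left inverse of it are both graph homomorphisms, and homomorphisms do not
increase distance. The left inverse is arbitrary off the names, which are the only non-isolated
vertices. -/
theorem edist_name (x y : V) : (nameGraph Γ ν).edist (ν.name x) (ν.name y) = Γ.edist x y := by
  refine le_antisymm ?_ ?_
  · exact SimpleGraph.Hom.edist_le (⟨ν.name, fun h => nameGraph_adj_name.2 h⟩ :
      Γ →g nameGraph Γ ν) x y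
  · let f : nameGraph Γ ν →g Γ := ⟨Function.extend ν.name id fun _ => x, by
      rintro _ _ ⟨a, b, rfl, rfl, h⟩
      simpa [ν.name_injective.extend_apply] using h⟩
    have hf : ∀ a, f (ν.name a) = a := fun a => ν.name_injective.extend_apply id (fun _ => x) a
    simpa only [hf] using f.edist_le (ν.name x) (ν.name y)

/-- The degree tells when a search for neighbours is complete: a duplicate-free list of neighbours
with that length contains them all. -/
theorem IsHighlyComputableGraph.hasNeighborLists (h : IsHighlyComputableGraph Γ ν) :
    HasNeighborLists (nameGraph Γ ν).Adj := by
  classical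
  have hadj : ComputablePred fun p : ℕ × ℕ => (nameGraph Γ ν).Adj p.1 p.2 := by
    refine (h.computable.comp' (f := fun p : ℕ × ℕ => Nat.pair p.1 p.2)
      Primrec₂.natPair.to_comp).of_eq ?_
    rintro ⟨a, b⟩
    constructor
    · rintro ⟨hmem, hp⟩
      exact ⟨_, _, (ν.name_toEquiv ⟨(Nat.pair a b).unpair.1, hmem.1⟩).trans (by simp),
        (ν.name_toEquiv ⟨(Nat.pair a b).unpair.2, hmem.2⟩).trans (by simp), hp⟩
    · rintro ⟨x, y, rfl, rfl, hxy⟩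
      refine ⟨(ν.prod ν).name_mem (x, y), ?_⟩
      change (ν.prod ν).toEquiv ⟨(ν.prod ν).name (x, y), _⟩ ∈ _
      rw [BijNumbering.toEquiv_name]
      exact hxy
  obtain ⟨g, hg, hgd⟩ := h.degree
  have hdeg : ∀ x, g (ν.name x) = (Γ.neighborSet x).ncard := fun x => by
    have := hgd ⟨ν.name x, ν.name_mem x⟩
    rw [ν.toEquiv_name] at this
    exact this
  have hset : ∀ x, {b | (nameGraph Γ ν).Adj (ν.name x) b} = ν.name '' Γ.neighborSet x := by
    intro x
    ext b
    constructor
    · rintro ⟨x', y, hx, rfl, hxy⟩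
      rw [ν.name_injective hx] at hxy
      exact ⟨y, hxy, rfl⟩
    · rintro ⟨y, hy, rfl⟩
      exact nameGraph_adj_name.2 hy
  have hcard : ∀ x, {b | (nameGraph Γ ν).Adj (ν.name x) b}.ncard = g (ν.name x) := fun x => by
    rw [hset, Set.ncard_image_of_injective _ ν.name_injective, hdeg]
  have hfin : ∀ x, {b | (nameGraph Γ ν).Adj (ν.name x) b}.Finite := fun x => by
    rw [hset]
    exact (h.locallyFinite x).image _
  obtain ⟨nb, hnb, hnb'⟩ := exists_computable_choice (R := fun (a : ℕ) (l : List ℕ) =>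
      (a ∈ ν.dom → l.Nodup ∧ l.length = g a ∧ ∀ b ∈ l, (nameGraph Γ ν).Adj a b) ∧
        (a ∉ ν.dom → l = [])) (by
      have hdom := ν.computable_dom.comp' (Computable.fst (α := ℕ) (β := List ℕ))
      refine (hdom.imp' (ComputablePred.and' ?_ (ComputablePred.and' ?_ ?_))).and'
        (hdom.not.imp' ?_)
      · exact ComputablePred.nodup Computable.snd
      · exact ComputablePred.eq' (Computable.list_length.comp Computable.snd)
          (hg.comp Computable.fst)
      · exact ComputablePred.forall_mem' (P := fun (p : ℕ × List ℕ) b => (nameGraph Γ ν).Adj p.1 b)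
          (hadj.comp' ((Computable.fst.comp Computable.fst).pair Computable.snd)) Computable.snd
      · exact ComputablePred.eq' Computable.snd (Computable.const [])) (by
      intro a
      by_cases ha : a ∈ ν.dom
      · rw [← ν.range_name] at ha
        obtain ⟨x, rfl⟩ := ha
        refine ⟨(hfin x).toFinset.toList, fun _ => ⟨Finset.nodup_toList _, ?_, by simp⟩,
          fun h => absurd (ν.name_mem x) h⟩
        rw [Finset.length_toList, ← hcard x, Set.ncard_eq_toFinset_card _ (hfin x)]
      · exact ⟨[], fun h => absurd h ha, fun _ => rfl⟩)
  refine ⟨nb, hnb, fun a b => ?_⟩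
  by_cases ha : a ∈ ν.dom
  · obtain ⟨h1, h2, h3⟩ := (hnb' a).1 ha
    rw [← ν.range_name] at ha
    obtain ⟨x, rfl⟩ := ha
    have : ((nb (ν.name x)).toFinset : Set ℕ) = {b | (nameGraph Γ ν).Adj (ν.name x) b} := by
      refine Set.eq_of_subset_of_ncard_le (fun b hb => h3 b (by simpa using hb)) ?_ (hfin x)
      rw [hcard, Set.ncard_coe_finset, List.toFinset_card_of_nodup h1, h2]
    rw [← List.mem_toFinset, ← Finset.mem_coe, this]
    rfl
  · rw [(hnb' a).2 ha]
    refine ⟨fun h => by simp at h, ?_⟩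
    rintro ⟨x, y, rfl, -, -⟩
    exact absurd (ν.name_mem x) ha

end Transfer

/-! ### Integer addition on standard names. -/

section IntCode

/-- Addition of integers in terms of their standard names. -/
def intCodeAdd (i j : ℕ) : ℕ :=
  -- The sums of the positive and of the negative parts; a negative total `-(n - p)` has the odd
  -- name `2 * (n - p) - 1`.
  let p := (if i % 2 = 0 then i / 2 else 0) + (if j % 2 = 0 then j / 2 else 0)
  let n := (if i % 2 = 0 then 0 else i / 2 + 1) + (if j % 2 = 0 then 0 else j / 2 + 1)
  if n ≤ p then 2 * (p - n) else 2 * (n - p) - 1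

theorem primrec₂_intCodeAdd : Primrec₂ intCodeAdd := by
  have hp : Primrec fun i : ℕ => if i % 2 = 0 then i / 2 else 0 :=
    Primrec.ite (Primrec.eq.comp (Primrec.nat_mod.comp Primrec.id (Primrec.const 2))
      (Primrec.const 0)) (Primrec.nat_div.comp Primrec.id (Primrec.const 2)) (Primrec.const 0)
  have hn : Primrec fun i : ℕ => if i % 2 = 0 then 0 else i / 2 + 1 :=
    Primrec.ite (Primrec.eq.comp (Primrec.nat_mod.comp Primrec.id (Primrec.const 2))
      (Primrec.const 0)) (Primrec.const 0)
      (Primrec.succ.comp (Primrec.nat_div.comp Primrec.id (Primrec.const 2)))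
  have hP := Primrec.nat_add.comp (hp.comp (Primrec.fst (α := ℕ) (β := ℕ))) (hp.comp Primrec.snd)
  have hN := Primrec.nat_add.comp (hn.comp (Primrec.fst (α := ℕ) (β := ℕ))) (hn.comp Primrec.snd)
  exact Primrec.ite (Primrec.nat_le.comp hN hP)
    (Primrec.nat_mul.comp (Primrec.const 2) (Primrec.nat_sub.comp hP hN))
    (Primrec.nat_sub.comp (Primrec.nat_mul.comp (Primrec.const 2) (Primrec.nat_sub.comp hN hP))
      (Primrec.const 1))

theorem intEquivNat_natCast (n : ℕ) : Equiv.intEquivNat (n : ℤ) = 2 * n := rfl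

theorem intEquivNat_negSucc (n : ℕ) : Equiv.intEquivNat (Int.negSucc n) = 2 * n + 1 := rfl

theorem intCodeAdd_intEquivNat (a b : ℤ) :
    intCodeAdd (Equiv.intEquivNat a) (Equiv.intEquivNat b) = Equiv.intEquivNat (a + b) := by
  have h : ∀ a : ℤ, Equiv.intEquivNat a = if 0 ≤ a then 2 * a.toNat else 2 * (-a).toNat - 1 := by
    rintro (n | n)
    · simp [intEquivNat_natCast]
    · rw [intEquivNat_negSucc, if_neg (by omega)]
      omega
  rw [h a, h b, h (a + b)]
  simp only [intCodeAdd]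
  split_ifs <;> omega

end IntCode

/-! ### Bounded lines and actions of ℤ. -/

section Action

variable {V : Type u} {Γ : SimpleGraph V} {ν : BijNumbering V}

theorem IsTranslationLikeAction.of_equiv {z : ℤ ≃ V} {C : ℕ}
    (hz : ∀ i, Γ.edist (z i) (z (i + 1)) ≤ C) :
    IsTranslationLikeAction (pathMetric Γ) fun x (n : ℤ) => z (z.symm x + n) where
  act_zero x := by simp
  act_add x g h := by simp [add_assoc]
  free x h hx := by
    have : z.symm x + h = z.symm x := z.injective (by simpa using hx)
    simpa using this
  bounded h := by
    refine ⟨h.natAbs * C, fun x => ?_⟩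
    obtain ⟨i, rfl⟩ := z.surjective x
    change Γ.edist (z i) (z (z.symm (z i) + h)) ≤ _
    rw [Equiv.symm_apply_apply]
    obtain ⟨n, rfl | rfl⟩ := h.eq_nat_or_neg
    · simpa using edist_le_mul_of_step hz i n
    · have := edist_le_mul_of_step hz (i - n) n
      rw [SimpleGraph.edist_comm]
      simpa [sub_eq_add_neg] using this

theorem isTransitiveAction_of_equiv (z : ℤ ≃ V) :
    IsTransitiveAction fun x (n : ℤ) => z (z.symm x + n) :=
  fun x y => ⟨z.symm y - z.symm x, by simp⟩

theorem exists_computable_action_of_hasBoundedLine (hq : HasBoundedLine (nameGraph Γ ν) ν.dom)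
    (hfin : ∀ x y, Γ.edist x y ≠ ⊤) :
    ∃ act : V → ℤ → V, IsTranslationLikeAction (pathMetric Γ) act ∧ IsTransitiveAction act ∧
      IsComputableIntAction ν act := by
  obtain ⟨q, hq, hinj, hrange, C, hC⟩ := hq
  have hmem : ∀ n, q n ∈ ν.dom := fun n => hrange ▸ Set.mem_range_self n
  let Q : ℕ → V := fun n => ν.toEquiv ⟨q n, hmem n⟩
  have hQname : ∀ n, ν.name (Q n) = q n := fun n => ν.name_toEquiv _
  have hQ : Function.Bijective Q := by
    refine ⟨fun i j hij => hinj ?_, fun x => ?_⟩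
    · rw [← hQname, ← hQname, hij]
    · obtain ⟨n, hn⟩ : ν.name x ∈ Set.range q := hrange ▸ ν.name_mem x
      exact ⟨n, ν.name_injective ((hQname n).trans hn)⟩
  have hQC : ∀ n, Γ.edist (Q n) (Q (n + 2)) ≤ C := fun n => by
    rw [← edist_name (ν := ν), hQname, hQname]
    exact hC n
  let z : ℤ ≃ V := Equiv.intEquivNat.trans (Equiv.ofBijective Q hQ)
  -- Nonnegative integers run through the even terms of `Q` and negative ones through the odd terms.
  -- Only the jump from `-1` to `0`, from `Q 1` to `Q 0`, is not bounded by `C`.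
  have hz : ∀ i, Γ.edist (z i) (z (i + 1)) ≤ (max C (Γ.edist (Q 1) (Q 0)).toNat : ℕ) := by
    rintro (n | _ | n)
    · exact (hQC (2 * n)).trans (by exact_mod_cast le_max_left _ _)
    · change Γ.edist (Q 1) (Q 0) ≤ _
      nth_rewrite 1 [← ENat.natCast_toNat (hfin (Q 1) (Q 0))]
      exact Nat.cast_le.2 (le_max_right _ _)
    · change Γ.edist (Q (2 * n + 1 + 2)) (Q (2 * n + 1)) ≤ _
      rw [SimpleGraph.edist_comm]
      exact (hQC (2 * n + 1)).trans (by exact_mod_cast le_max_left _ _)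
  refine ⟨_, IsTranslationLikeAction.of_equiv hz, isTransitiveAction_of_equiv z, ?_⟩
  -- The inverse of `q` is computed by search, so acting is: find the index, add, apply `q`.
  obtain ⟨r, hr, hr'⟩ := exists_computable_choice (R := fun a i : ℕ => a ∈ ν.dom → q i = a)
    ((ν.computable_dom.comp' Computable.fst).imp'
      (ComputablePred.eq' (hq.comp Computable.snd) Computable.fst)) (by
    intro a
    by_cases ha : a ∈ ν.dom
    · obtain ⟨i, hi⟩ : a ∈ Set.range q := hrange ▸ ha
      exact ⟨i, fun _ => hi⟩
    · exact ⟨0, fun h => absurd h ha⟩)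
  refine ⟨fun k => q (intCodeAdd (r k.unpair.1) k.unpair.2), ?_, ?_⟩
  · exact hq.comp (primrec₂_intCodeAdd.to_comp.comp
      (hr.comp (Computable.fst.comp Computable.unpair)) (Computable.snd.comp Computable.unpair))
  · rintro ⟨k, hk⟩
    obtain ⟨x, hx⟩ : ∃ x, ν.toEquiv ⟨k.unpair.1, hk.1⟩ = x := ⟨_, rfl⟩
    have hxk : ν.name x = k.unpair.1 := hx ▸ ν.name_toEquiv _
    change q (intCodeAdd (r k.unpair.1) k.unpair.2) = ν.name (z (z.symm
      (ν.toEquiv ⟨k.unpair.1, hk.1⟩) + Equiv.intEquivNat.symm k.unpair.2))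
    rw [hx, ← hxk]
    obtain ⟨i, rfl⟩ := z.surjective x
    have hri : r (ν.name (z i)) = Equiv.intEquivNat i :=
      hinj ((hr' _ (ν.name_mem _)).trans (hQname _))
    rw [hri, Equiv.symm_apply_apply]
    obtain ⟨j, hj⟩ := Equiv.intEquivNat.surjective k.unpair.2
    rw [← hj, Equiv.symm_apply_apply, intCodeAdd_intEquivNat]
    exact (hQname _).symm

/-- The orbit map of a point is injective by freeness and surjective by transitivity; its jumps are
bounded by the constant for `1`. -/
theorem IsHighlyComputableGraph.exists_computable_action (h : IsHighlyComputableGraph Γ ν)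
    {act : V → ℤ → V} (hact : IsTranslationLikeAction (pathMetric Γ) act)
    (htrans : IsTransitiveAction act) :
    ∃ act : V → ℤ → V, IsTranslationLikeAction (pathMetric Γ) act ∧ IsTransitiveAction act ∧
      IsComputableIntAction ν act := by
  rcases isEmpty_or_nonempty V with hV | ⟨⟨x₀⟩⟩
  · refine ⟨act, hact, htrans, id, Computable.id, fun n => ?_⟩
    exact isEmptyElim ((ν.prod BijNumbering.int).toEquiv n).1
  obtain ⟨C, hC⟩ := hact.bounded 1
  have hstep : ∀ i, Γ.edist (act x₀ i) (act x₀ (i + 1)) ≤ C := fun i => by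
    rw [hact.act_add]
    exact hC _
  have hinj : Function.Injective (act x₀) := fun i j hij => by
    have : act (act x₀ j) (i - j) = act x₀ j := by
      rw [← hact.act_add, add_sub_cancel, hij]
    exact sub_eq_zero.1 (hact.free _ _ this)
  refine exists_computable_action_of_hasBoundedLine
    (hasBoundedLine_of_int h.hasNeighborLists ν.computable_dom
      (p := fun i => ν.name (act x₀ i)) (ν.name_injective.comp hinj) ?_ (C := C) ?_) ?_
  · rw [← ν.range_name]
    exact Function.Surjective.range_comp (htrans x₀) ν.name
  · intro i
    rw [edist_name]
    exact hstep i
  · intro x y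
    obtain ⟨i, rfl⟩ := htrans x₀ x
    obtain ⟨j, rfl⟩ := htrans x₀ y
    rcases le_total i j with hij | hij
    · obtain ⟨n, rfl⟩ := Int.le.dest hij
      exact ne_top_of_le_ne_top (ENat.natCast_ne_top _) (edist_le_mul_of_step hstep i n)
    · obtain ⟨n, rfl⟩ := Int.le.dest hij
      rw [SimpleGraph.edist_comm]
      exact ne_top_of_le_ne_top (ENat.natCast_ne_top _) (edist_le_mul_of_step hstep j n)

end Action

/-! ### Computable group numberings and Cayley graphs. -/

section Groups

variable {G : Type v} [Group G]

theorem BijNumbering.name_prod {X Y : Type*} (ν : BijNumbering X) (μ : BijNumbering Y) (x : X)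
    (y : Y) : (ν.prod μ).name (x, y) = Nat.pair (ν.name x) (μ.name y) := rfl

/-- The neighbours of `x` are the products `x * g` with `g` in a fixed finite set, so adjacency is
tested by finitely many multiplications and the degree is constant. -/
theorem IsComputableGroupNumbering.isHighlyComputableGraph {ν : BijNumbering G}
    (hν : IsComputableGroupNumbering ν) {S : Set G} (hS : S.Finite) :
    IsHighlyComputableGraph (SimpleGraph.mulCayley S) ν := by
  classical
  let S' : Set G := {g | g ≠ 1 ∧ (g ∈ S ∨ g⁻¹ ∈ S)}
  have hS' : S'.Finite := (hS.union (hS.preimage inv_injective.injOn)).subset fun g hg => hg.2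
  have hadj : ∀ x y, (SimpleGraph.mulCayley S).Adj x y ↔ ∃ g ∈ S', x * g = y := by
    intro x y
    rw [SimpleGraph.mulCayley_adj']
    constructor
    · rintro ⟨hxy, g, hg, h | h⟩
      · exact ⟨g, ⟨fun h1 => hxy (by rw [← h, h1, mul_one]), Or.inl hg⟩, h⟩
      · refine ⟨g⁻¹, ⟨fun h1 => hxy ?_, Or.inr (by simpa)⟩, by rw [h]; simp⟩
        rw [h, inv_eq_one.1 h1, mul_one]
    · rintro ⟨g, ⟨h1, hg⟩, rfl⟩
      refine ⟨fun h => h1 (by simpa using h), ?_⟩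
      rcases hg with hg | hg
      · exact ⟨g, hg, Or.inl rfl⟩
      · exact ⟨g⁻¹, hg, Or.inr (by simp)⟩
  have hnbr : ∀ x, (SimpleGraph.mulCayley S).neighborSet x = (fun g => x * g) '' S' := by
    intro x
    ext y
    rw [SimpleGraph.mem_neighborSet, hadj]
    rfl
  obtain ⟨m, hm, hm'⟩ := hν
  have hmul : ∀ x y, m (Nat.pair (ν.name x) (ν.name y)) = ν.name (x * y) := fun x y => by
    have := hm' ⟨(ν.prod ν).name (x, y), (ν.prod ν).name_mem (x, y)⟩
    rw [BijNumbering.toEquiv_name] at this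
    exact this
  refine ⟨?_, fun x => ?_, ?_⟩
  · have hdom : ComputablePred fun n => n ∈ (ν.prod ν).dom := (ν.prod ν).computable_dom
    refine (hdom.and' (ComputablePred.exists_mem'
      (P := fun n c => m (Nat.pair n.unpair.1 c) = n.unpair.2) (ComputablePred.eq'
        (hm.comp (Primrec₂.natPair.to_comp.comp
          (Computable.fst.comp (Computable.unpair.comp Computable.fst)) Computable.snd))
        (Computable.snd.comp (Computable.unpair.comp Computable.fst)))
      (Computable.const (hS'.toFinset.toList.map ν.name)))).of_eq fun n => ?_
    by_cases hn : n ∈ (ν.prod ν).dom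
    · rw [← (ν.prod ν).range_name] at hn
      obtain ⟨⟨x, y⟩, rfl⟩ := hn
      have : (ν.prod ν).toEquiv ⟨(ν.prod ν).name (x, y), (ν.prod ν).name_mem _⟩ = (x, y) :=
        (ν.prod ν).toEquiv_name _
      have hlist : (∃ c ∈ hS'.toFinset.toList.map ν.name,
          m (Nat.pair ((ν.prod ν).name (x, y)).unpair.1 c) = ((ν.prod ν).name (x, y)).unpair.2) ↔
          ∃ g ∈ S', x * g = y := by
        simp only [BijNumbering.name_prod, Nat.unpair_pair, List.mem_map, Finset.mem_toList,
          Set.Finite.mem_toFinset, exists_exists_and_eq_and, hmul, ν.name_injective.eq_iff]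
      rw [hlist, ← hadj]
      have hmem : (ν.prod ν).toEquiv ⟨(ν.prod ν).name (x, y), (ν.prod ν).name_mem _⟩ ∈
          {p : G × G | (SimpleGraph.mulCayley S).Adj p.1 p.2} ↔
          (SimpleGraph.mulCayley S).Adj x y := by
        rw [this]
        rfl
      exact ⟨fun h => ⟨h.1, hmem.2 h.2⟩, fun h => ⟨h.1, hmem.1 h.2⟩⟩
    · exact ⟨fun h => absurd h.1 hn, fun h => absurd h.1 hn⟩
  · rw [hnbr]
    exact hS'.image _
  · refine ⟨fun _ => S'.ncard, Computable.const _, fun n => ?_⟩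
    change S'.ncard = ((SimpleGraph.mulCayley S).neighborSet (ν.toEquiv n)).ncard
    rw [hnbr, Set.ncard_image_of_injective _ (mul_right_injective _)]

variable {k : ℕ} (s : Fin k → G)

theorem wordEval_append (w w' : List (Fin k × Bool)) :
    wordEval s (w ++ w') = wordEval s w * wordEval s w' := by
  simp [wordEval]

/-- The formal inverse of a word. -/
def wordInv (w : List (Fin k × Bool)) : List (Fin k × Bool) :=
  (w.map fun a => (a.1, !a.2)).reverse

theorem wordEval_wordInv (w : List (Fin k × Bool)) : wordEval s (wordInv w) = (wordEval s w)⁻¹ := by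
  induction w with
  | nil => simp [wordEval, wordInv]
  | cons a w ih =>
    have h : wordInv (a :: w) = wordInv w ++ [(a.1, !a.2)] := by simp [wordInv]
    rw [h, wordEval_append, ih, show a :: w = [a] ++ w from rfl, wordEval_append, mul_inv_rev]
    congr 1
    obtain ⟨i, b⟩ := a
    cases b <;> simp [wordEval]

theorem computable_wordInv : Computable (wordInv (k := k)) :=
  Computable.list_reverse.comp (Primrec.list_map (f := fun w : List (Fin k × Bool) => w)
    (g := fun _ a => (a.1, !a.2)) Primrec.id
    (Primrec.pair (Primrec.fst.comp Primrec.snd)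
      (Primrec.not.comp (Primrec.snd.comp Primrec.snd)))).to_comp

theorem exists_wordEval_eq (hs : Subgroup.closure (Set.range s) = ⊤) (g : G) :
    ∃ w, wordEval s w = g := by
  have hg : g ∈ Subgroup.closure (Set.range s) := hs ▸ Subgroup.mem_top g
  induction hg using Subgroup.closure_induction with
  | mem x hx =>
    obtain ⟨i, rfl⟩ := hx
    exact ⟨[(i, true)], by simp [wordEval]⟩
  | one => exact ⟨[], by simp [wordEval]⟩
  | mul x y _ _ hx hy =>
    obtain ⟨w, rfl⟩ := hx
    obtain ⟨w', rfl⟩ := hy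
    exact ⟨w ++ w', wordEval_append s w w'⟩
  | inv x _ hx =>
    obtain ⟨w, rfl⟩ := hx
    exact ⟨wordInv w, wordEval_wordInv s w⟩

/-- Each element is named by its least code of a word, and the word problem decides leastness. The
name of a product is found by searching for a name whose word equals the concatenation in `G`. -/
theorem HasDecidableWordProblem.exists_isComputableGroupNumbering
    (hG : HasDecidableWordProblem G) :
    ∃ ν : BijNumbering G, IsComputableGroupNumbering ν := by
  classical
  obtain ⟨k, s, hs, hwp⟩ := hG
  -- Numbers that code no word are read as the empty word, which makes evaluation total.
  let word : ℕ → List (Fin k × Bool) := fun n => (Encodable.decode n).getD []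
  have hword : Computable word := Computable.option_getD Computable.decode (Computable.const [])
  let ev : ℕ → G := fun n => wordEval s (word n)
  have hev : Function.Surjective ev := fun g => by
    obtain ⟨w, rfl⟩ := exists_wordEval_eq s hs g
    exact ⟨Encodable.encode w, by simp [ev, word]⟩
  have heq : ComputablePred fun p : List (Fin k × Bool) × List (Fin k × Bool) =>
      wordEval s p.1 = wordEval s p.2 :=
    (hwp.comp' (Computable.list_append.comp Computable.fst
      (computable_wordInv.comp Computable.snd))).of_eq fun p => by
        rw [wordEval_append, wordEval_wordInv, mul_inv_eq_one]
  let dom : Set ℕ := {n | ∀ m < n, ev m ≠ ev n}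
  have hdom : ComputablePred fun n => n ∈ dom :=
    ComputablePred.forall_lt' (P := fun n m => ev m ≠ ev n)
      (heq.comp' ((hword.comp Computable.snd).pair (hword.comp Computable.fst))).not Computable.id
  have hbij : Function.Bijective fun n : dom => ev n := by
    constructor
    · rintro ⟨i, hi⟩ ⟨j, hj⟩ hij
      refine Subtype.ext ?_
      rcases lt_trichotomy i j with h | h | h
      · exact absurd hij (hj i h)
      · exact h
      · exact absurd hij.symm (hi j h)
    · intro g
      refine ⟨⟨Nat.find (hev g), fun m hm h => ?_⟩, Nat.find_spec (hev g)⟩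
      exact Nat.find_min (hev g) hm (h.trans (Nat.find_spec (hev g)))
  let ν : BijNumbering G := ⟨dom, hdom, Equiv.ofBijective _ hbij⟩
  have hname : ∀ g, ev (ν.name g) = g := fun g => ν.toEquiv_name g
  refine ⟨ν, ?_⟩
  obtain ⟨m, hm, hm'⟩ := exists_computable_choice (R := fun n c : ℕ => c ∈ dom ∧
      wordEval s (word c) = wordEval s (word n.unpair.1 ++ word n.unpair.2))
    ((hdom.comp' Computable.snd).and' (heq.comp' ((hword.comp Computable.snd).pair
      (Computable.list_append.comp
        (hword.comp (Computable.fst.comp (Computable.unpair.comp Computable.fst)))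
        (hword.comp (Computable.snd.comp (Computable.unpair.comp Computable.fst))))))) (by
    intro n
    exact ⟨ν.name _, ν.name_mem _, hname _⟩)
  refine ⟨m, hm, fun n => ?_⟩
  obtain ⟨h1, h2⟩ := hm' n
  have h3 : ev (m n) = ev (n : ℕ).unpair.1 * ev (n : ℕ).unpair.2 :=
    h2.trans (wordEval_append s _ _)
  exact (ν.name_toEquiv ⟨m n, h1⟩).symm.trans (congrArg ν.name h3)

end Groups

theorem mainTheorem10 :
    (∀ (V : Type u) (Γ : SimpleGraph V) (ν : BijNumbering V), IsHighlyComputableGraph Γ ν →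
      ((∃ act : V → ℤ → V,
          IsTranslationLikeAction (pathMetric Γ) act ∧ IsTransitiveAction act) ↔
        ∃ act : V → ℤ → V, IsTranslationLikeAction (pathMetric Γ) act ∧ IsTransitiveAction act ∧
          IsComputableIntAction ν act)) ∧
    (∀ (G : Type v) [Group G] [Infinite G], HasDecidableWordProblem G →
      (∃ ν : BijNumbering G, IsComputableGroupNumbering ν) ∧
      ∀ ν : BijNumbering G, IsComputableGroupNumbering ν →
        ∀ S : Set G, S.Finite → Subgroup.closure S = ⊤ →
          ((∃ act : G → ℤ → G,
              IsTranslationLikeAction (wordMetric S) act ∧ IsTransitiveAction act) ↔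
            ∃ act : G → ℤ → G, IsTranslationLikeAction (wordMetric S) act ∧
              IsTransitiveAction act ∧ IsComputableIntAction ν act)) := by
  refine ⟨fun V Γ ν h => ⟨?_, ?_⟩, fun G _ _ hG =>
    ⟨hG.exists_isComputableGroupNumbering, fun ν hν S hS _ => ⟨?_, ?_⟩⟩⟩
  · rintro ⟨act, hact, htrans⟩
    exact h.exists_computable_action hact htrans
  · rintro ⟨act, hact, htrans, -⟩
    exact ⟨act, hact, htrans⟩
  · rintro ⟨act, hact, htrans⟩
    exact (hν.isHighlyComputableGraph hS).exists_computable_action hact htrans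
  · rintro ⟨act, hact, htrans, -⟩
    exact ⟨act, hact, htrans⟩
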